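/- Let $\vartheta>0$ and $a_1,a_2\in(0,1)$, and let $\alpha(n)$ be a real sequence with $n^{a_1}\le\alpha(n)\le n^{a_2}$ for all large $n$. For a permutation $\sigma\in S_n$ let $C_m=C_m(\sigma)$ be the number of cycles of length $m$ of $\sigma$. Let $\mathbb{P}_n$ be the Ewens measure on $S_n$, $$\mathbb{P}_n[\sigma]=\frac{\prod_{m=1}^n\vartheta^{C_m(\sigma)}}{\vartheta(\vartheta+1)\cdots(\vartheta+n-1)},$$ and let $\mathbb{P}_{n,\alpha}$ be $\mathbb{P}_n$ conditioned on the set $S_{n,\alpha}$ of permutations all of whose cycles have length at most $\alpha(n)$. For all large $n$ let $x_{n,\alpha}$ be the unique positive solution of $n=\vartheta\sum_{1\le j\le\alpha(n)}x_{n,\alpha}^{\,j}$, and put $\mu_j(n)=\vartheta\,x_{n,\alpha}^{\,j}/j$. **Theorem.** Let $b(n)$ be a sequence of non-negative integers with $b(n)=o(\alpha(n))$ as $n\to\infty$. Let $\mathbb{P}_{n,\vartheta,b(n),\alpha}$ be the law of $(C_1,\dots,C_{b(n)})$ under $\mathbb{P}_{n,\alpha}$, and let $\widehat{\mathbb{P}}_{b(n)}$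 be the law of $(Y_1,\dots,Y_{b(n)})$, where the $Y_j$ are independent Poisson variables with $\mathbb{E}[Y_j]=\mu_j(n)$. Write $\|P-Q\|_{\mathrm{TV}}=\sup_A|P(A)-Q(A)|$. Then, as $n\to\infty$, for every $\varepsilon>0$, $$\|\mathbb{P}_{n,\vartheta,b(n),\alpha}-\widehat{\mathbb{P}}_{b(n)}\|_{\mathrm{TV}}=\mathcal{O}\!\left(n^{\varepsilon}\left(\frac{\alpha(n)}{n}\right)^{5/12}\right).$$ If moreover $b(n)=o\big(\alpha(n)/\log n\big)$, then $$\|\mathbb{P}_{n,\vartheta,b(n),\alpha}-\widehat{\mathbb{P}}_{b(n)}\|_{\mathrm{TV}}=\mathcal{O}\!\left(\frac{\alpha(n)}{n}+\frac{b(n)\log n}{n^{5/12}\,\alpha(n)^{7/12}}\right).$$ The implied constants may depend on $\vartheta$, on the sequences $\alpha$ and $b$, and, in the first bound, on $\varepsilon$. -/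

import Mathlib

open Filter Asymptotics MeasureTheory ProbabilityTheory

noncomputable section

namespace RestrictedEwens

/-- The permutations of `n` points carry the discrete sigma-algebra. -/
instance permMeasurableSpace (n : ℕ) : MeasurableSpace (Equiv.Perm (Fin n)) := ⊤

/-- `C_m(σ)`: the number of cycles of length `m` in the decomposition of `σ` into disjoint cycles
(fixed points are the cycles of length `1`). -/
def cycleCount {n : ℕ} (m : ℕ) (σ : Equiv.Perm (Fin n)) : ℕ :=
  σ.partition.parts.count m

/-- The Ewens weight `∏_{m=1}^n ϑ^{C_m(σ)} / (ϑ (ϑ + 1) ⋯ (ϑ + n - 1))` of a permutation. -/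
def ewensWeight (ϑ : ℝ) (n : ℕ) (σ : Equiv.Perm (Fin n)) : ℝ :=
  (∏ m ∈ Finset.Icc 1 n, ϑ ^ cycleCount m σ) / ∏ i ∈ Finset.range n, (ϑ + i)

/-- The Ewens measure with parameter `ϑ` on the symmetric group of `n` points. -/
def ewensMeasure (ϑ : ℝ) (n : ℕ) : Measure (Equiv.Perm (Fin n)) :=
  ∑ σ : Equiv.Perm (Fin n), ENNReal.ofReal (ewensWeight ϑ n σ) • Measure.dirac σ

/-- `S_{n,α}`: the permutations without cycles longer than `a`. -/
def shortCyclePerms (n : ℕ) (a : ℝ) : Set (Equiv.Perm (Fin n)) :=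
  {σ | ∀ m : ℕ, a < m → cycleCount m σ = 0}

/-- The Ewens measure conditioned on having no cycle longer than `a`. -/
def restrictedEwens (ϑ : ℝ) (n : ℕ) (a : ℝ) : Measure (Equiv.Perm (Fin n)) :=
  ProbabilityTheory.cond (ewensMeasure ϑ n) (shortCyclePerms n a)

/-- The law of `(C_1, …, C_b)` under the conditioned Ewens measure; the coordinate `j : Fin b`
stands for the cycle length `j + 1`. -/
def cycleCountLaw (ϑ : ℝ) (n : ℕ) (a : ℝ) (b : ℕ) : Measure (Fin b → ℕ) :=
  (restrictedEwens ϑ n a).map fun σ j => cycleCount (j.val + 1) σ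

/-- `x` is a positive solution of `n = ϑ ∑_{1 ≤ j ≤ a} x^j`. -/
def IsSaddle (ϑ : ℝ) (n : ℕ) (a : ℝ) (x : ℝ) : Prop :=
  0 < x ∧ (n : ℝ) = ϑ * ∑ j ∈ Finset.Icc 1 ⌊a⌋₊, x ^ j

/-- The saddle point equation has exactly one positive solution. -/
theorem existsUnique_isSaddle {ϑ : ℝ} (hϑ : 0 < ϑ) {n : ℕ} (hn : 1 ≤ n) {a : ℝ} (ha : 1 ≤ a) :
    ∃! x, IsSaddle ϑ n a x := by
  have hfl : 1 ≤ ⌊a⌋₊ := Nat.one_le_floor_iff a |>.2 ha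
  have hn0 : (0 : ℝ) < n := by exact_mod_cast hn
  have hmono : ∀ x y : ℝ, 0 < x → x < y →
      ∑ j ∈ Finset.Icc 1 ⌊a⌋₊, x ^ j < ∑ j ∈ Finset.Icc 1 ⌊a⌋₊, y ^ j := by
    intro x y hx hxy
    refine Finset.sum_lt_sum_of_nonempty ⟨1, by simp [hfl]⟩ fun j hj => ?_
    exact pow_lt_pow_left₀ hxy hx.le (by have := (Finset.mem_Icc.1 hj).1; omega)
  have hcont : Continuous fun x : ℝ => ϑ * ∑ j ∈ Finset.Icc 1 ⌊a⌋₊, x ^ j := by fun_prop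
  have h0 : ϑ * ∑ j ∈ Finset.Icc 1 ⌊a⌋₊, (0 : ℝ) ^ j = 0 := by
    rw [Finset.sum_eq_zero, mul_zero]
    intro j hj
    exact zero_pow (by have := (Finset.mem_Icc.1 hj).1; omega)
  have h1 : (n : ℝ) ≤ ϑ * ∑ j ∈ Finset.Icc 1 ⌊a⌋₊, (n / ϑ : ℝ) ^ j := by
    have : (n / ϑ : ℝ) ^ 1 ≤ ∑ j ∈ Finset.Icc 1 ⌊a⌋₊, (n / ϑ : ℝ) ^ j :=
      Finset.single_le_sum (f := fun j => (n / ϑ : ℝ) ^ j)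
        (fun j _ => by positivity) (by simp [hfl])
    calc (n : ℝ) = ϑ * (n / ϑ : ℝ) ^ 1 := by field_simp
      _ ≤ _ := mul_le_mul_of_nonneg_left this hϑ.le
  obtain ⟨x, hx, hxe⟩ := intermediate_value_Icc (a := (0 : ℝ)) (b := n / ϑ) (by positivity)
    hcont.continuousOn (show (n : ℝ) ∈ _ from ⟨by simpa only [h0] using hn0.le, h1⟩)
  have hx0 : 0 < x := by
    rcases hx.1.lt_or_eq with h | h
    · exact h
    · exfalso
      subst h
      simp only [h0] at hxe
      linarith
  refine ⟨x, ⟨hx0, hxe.symm⟩, ?_⟩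
  rintro y ⟨hy0, hye⟩
  have key := mul_left_cancel₀ hϑ.ne' (hye.symm.trans hxe.symm)
  rcases lt_trichotomy y x with h | h | h
  · exact absurd key (hmono y x hy0 h).ne
  · exact h
  · exact absurd key (hmono x y hx0 h).ne'

open Classical in
/-- `x_{n,α}`: the unique positive solution of `n = ϑ ∑_{1 ≤ j ≤ a} x^j`. -/
def saddlePoint (ϑ : ℝ) (n : ℕ) (a : ℝ) : ℝ :=
  if h : ∃ x, IsSaddle ϑ n a x then h.choose else 0

theorem saddlePoint_spec {ϑ : ℝ} (hϑ : 0 < ϑ) {n : ℕ} (hn : 1 ≤ n) {a : ℝ} (ha : 1 ≤ a) :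
    IsSaddle ϑ n a (saddlePoint ϑ n a) := by
  have h : ∃ x, IsSaddle ϑ n a x := (existsUnique_isSaddle hϑ hn ha).exists
  rw [saddlePoint, dif_pos h]
  exact h.choose_spec

/-- `μ_m(n) = ϑ x_{n,α}^m / m`. -/
def poissonMean (ϑ : ℝ) (n : ℕ) (a : ℝ) (m : ℕ) : ℝ :=
  ϑ * saddlePoint ϑ n a ^ m / m

/-- The law of independent Poisson variables `(Y_1, …, Y_b)` with `E[Y_j] = μ_j(n)`; the
coordinate `j : Fin b` stands for the index `j + 1`. -/
def poissonLaw (ϑ : ℝ) (n : ℕ) (a : ℝ) (b : ℕ) : Measure (Fin b → ℕ) :=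
  Measure.pi fun j => poissonMeasure (poissonMean ϑ n a (j.val + 1)).toNNReal

/-- Total variation distance `sup_A |μ(A) - ν(A)|` of two probability measures. -/
def tvDist {Ω : Type*} [MeasurableSpace Ω] (μ ν : Measure Ω) : ℝ :=
  ⨆ A : {A : Set Ω // MeasurableSet A}, |μ.real A.1 - ν.real A.1|

end RestrictedEwens

end

/-!
Condition on the total size. Under the Ewens measure restricted to cycle lengths at most
`N = ⌊α⌋`, the cycle counts are independent Poisson variables `Y_1, …, Y_N` with means
`μ_j = ϑ x^j / j`, conditioned on `T = ∑ j Y_j = n`; this holds for every tilt `x > 0`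
(`exists_ewensMeasure_real_eq_mul_twoBlockLaw`) and comes from Cauchy's count of the permutations
with given cycle counts. Write `T = S + R` with `S` the size `∑ j Y_j` of the block `j ≤ b` and `R`
that of the block `b < j ≤ N`. If the atoms of the law of `R` are Lipschitz with constant `Λ`, then
`P(R = n - s)` differs from `P(R = n)` by at most `Λ s`, so that conditioning on `T = n` moves the
law of `(Y_1, …, Y_b)` by at most `2 Λ E[S] / P(T = n)` in total variation
(`tvDist_cycleCountLaw_le`).

At the saddle point `x` one has `E[T] = n`, and both `Λ` and `P(T = n)` are read off from Fourier
inversion. The modulus of the characteristic function of `R` is `exp (-∑ μ_j (1 - cos (j t)))`. The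
`L ≈ N / log n` largest cycle lengths all have weights comparable to the largest one, and a window
of `L` consecutive cosines cannot align: for `|t| ≥ 2π / L` by summing the cosines in closed form,
for smaller `t` by doubling the frequency (`half_mul_min_le_sum_one_sub_cos`). This gives
`Λ = O(log^3 n / (n N))` (`abs_blockLaw_real_sub_le`). For `T` itself the phase of the centred
characteristic function is of third order in `t`, so the frequencies `|t| ≤ (n N)^(-1/2)` yield
`P(T = n) ≥ c / √(n N)` (`le_two_pi_mul_twoBlockLaw_real`).

Altogether the distance is `O(log^3 n * b x^b / √(n α))`. Since `α log x = O(log n)`, the factor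
`x^b` is `n^(o(1))` for `b = o(α)` and bounded for `b = o(α / log n)`. Up to a constant, both claimed
rates exceed `b x^b / √(n α)` by a factor of at least `(n / α)^(1/12)`, which is bounded below by a
positive power of `n` and absorbs the logarithms; the summand `α / n` of the second rate is not
needed.
-/

noncomputable section

namespace RestrictedEwens

/-! ### Permutations with prescribed cycle counts -/

theorem cycleCount_eq {n : ℕ} (m : ℕ) (σ : Equiv.Perm (Fin n)) :
    cycleCount m σ = σ.cycleType.count m + if m = 1 then n - σ.cycleType.sum else 0 := by
  rw [cycleCount, Equiv.Perm.parts_partition, Multiset.count_add, Multiset.count_replicate,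
    Fintype.card_fin, Equiv.Perm.sum_cycleType]
  simp only [eq_comm]

/-- A permutation is determined up to conjugacy by its cycle counts; the cycle type in Mathlib
omits the fixed points, hence the range `2 ≤ m`. -/
theorem forall_cycleCount_eq_iff {n N : ℕ} (hN : 1 ≤ N) {c : ℕ → ℕ}
    (hc : ∀ m, m ∉ Finset.Icc 1 N → c m = 0) (hsum : ∑ m ∈ Finset.Icc 1 N, m * c m = n)
    (σ : Equiv.Perm (Fin n)) :
    (∀ m, cycleCount m σ = c m) ↔
      σ.cycleType = ∑ m ∈ Finset.Icc 2 N, Multiset.replicate (c m) m := by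
  have hcount : ∀ k, (∑ m ∈ Finset.Icc 2 N, Multiset.replicate (c m) m).count k =
      if 2 ≤ k then c k else 0 := by
    intro k
    rw [Multiset.count_sum']
    simp only [Multiset.count_replicate]
    rw [Finset.sum_ite_eq']
    by_cases hk : k ∈ Finset.Icc 2 N
    · rw [if_pos hk, if_pos (Finset.mem_Icc.1 hk).1]
    · rw [if_neg hk]
      split_ifs with h
      · exact (hc k fun h' => hk (Finset.mem_Icc.2 ⟨h, (Finset.mem_Icc.1 h').2⟩)).symm
      · rfl
  have hins : Finset.Icc 1 N = insert 1 (Finset.Icc 2 N) := by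
    ext k; simp only [Finset.mem_Icc, Finset.mem_insert]; omega
  constructor
  · intro h
    ext k
    rw [hcount]
    split_ifs with hk
    · rw [← h k, cycleCount_eq, if_neg (by omega), add_zero]
    · exact Multiset.count_eq_zero.2 fun h' =>
        hk (Equiv.Perm.two_le_of_mem_cycleType h')
  · intro h m
    rw [cycleCount_eq, h, hcount]
    rcases lt_trichotomy m 1 with hm | rfl | hm
    · rw [if_neg (by omega), if_neg (by omega), hc m (by simp; omega)]
    · rw [if_neg (by omega), if_pos rfl, Multiset.sum_sum]
      rw [hins, Finset.sum_insert (by simp)] at hsum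
      simp only [Multiset.sum_replicate, smul_eq_mul]
      have : ∑ x ∈ Finset.Icc 2 N, c x * x = ∑ x ∈ Finset.Icc 2 N, x * c x :=
        Finset.sum_congr rfl fun _ _ => mul_comm _ _
      omega
    · rw [if_pos (by omega), if_neg (by omega), add_zero]

/-- Cauchy's formula for the number of permutations with prescribed cycle counts. -/
theorem card_cycleCount_eq_mul {n N : ℕ} (hN : 1 ≤ N) {c : ℕ → ℕ}
    (hc : ∀ m, m ∉ Finset.Icc 1 N → c m = 0) (hsum : ∑ m ∈ Finset.Icc 1 N, m * c m = n)
    (s : Finset (Equiv.Perm (Fin n))) (hs : ∀ σ, σ ∈ s ↔ ∀ m, cycleCount m σ = c m) :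
    s.card * ∏ m ∈ Finset.Icc 1 N, m ^ c m * (c m).factorial = n.factorial := by
  set M : Multiset ℕ := ∑ m ∈ Finset.Icc 2 N, Multiset.replicate (c m) m with hM
  have hins : Finset.Icc 1 N = insert 1 (Finset.Icc 2 N) := by
    ext k; simp only [Finset.mem_Icc, Finset.mem_insert]; omega
  have hcount : ∀ k ∈ Finset.Icc 2 N, M.count k = c k := by
    intro k hk
    rw [hM, Multiset.count_sum']
    simp only [Multiset.count_replicate]
    rw [Finset.sum_ite_eq', if_pos hk]
  have hmem : ∀ k ∈ M, k ∈ Finset.Icc 2 N := by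
    intro k hk
    rw [hM, Multiset.mem_sum] at hk
    obtain ⟨m, hm, hk⟩ := hk
    rwa [Multiset.eq_of_mem_replicate hk]
  have hMsum : M.sum = ∑ m ∈ Finset.Icc 2 N, m * c m := by
    rw [hM, Multiset.sum_sum]
    exact Finset.sum_congr rfl fun m _ => by rw [Multiset.sum_replicate, smul_eq_mul, mul_comm]
  have hMprod : M.prod = ∏ m ∈ Finset.Icc 2 N, m ^ c m := by
    rw [hM, Multiset.prod_sum]
    exact Finset.prod_congr rfl fun m _ => by rw [Multiset.prod_replicate]
  have hMfac : ∏ k ∈ M.toFinset, (M.count k).factorial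
      = ∏ m ∈ Finset.Icc 2 N, (c m).factorial := by
    rw [Finset.prod_subset (s₂ := Finset.Icc 2 N)]
    · exact Finset.prod_congr rfl fun k hk => by rw [hcount k hk]
    · intro k hk; exact hmem k (Multiset.mem_toFinset.1 hk)
    · intro k _ hk
      rw [Multiset.count_eq_zero.2 fun h => hk (Multiset.mem_toFinset.2 h), Nat.factorial_zero]
  rw [hins, Finset.sum_insert (by simp), ← hMsum] at hsum
  have hseq : s = Finset.univ.filter fun σ : Equiv.Perm (Fin n) => σ.cycleType = M := by
    ext σ
    rw [hs, forall_cycleCount_eq_iff hN hc, Finset.mem_filter]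
    · simp [hM]
    · rw [hins, Finset.sum_insert (by simp), ← hMsum]; exact hsum
  have key := Equiv.Perm.card_of_cycleType_mul_eq (Fin n) M
  rw [if_pos ⟨by rw [Fintype.card_fin]; omega, fun a ha => (Finset.mem_Icc.1 (hmem a ha)).1⟩,
    Fintype.card_fin, hMfac, hMprod, show n - M.sum = c 1 by omega] at key
  rw [hseq, ← key, hins, Finset.prod_insert (by simp), Finset.prod_mul_distrib]
  ring

/-- The total Ewens weight of a cycle type. -/
theorem sum_ewensWeight_cycleCount_eq {ϑ : ℝ} {n N : ℕ} (hN : 1 ≤ N) (hNn : N ≤ n)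
    {c : ℕ → ℕ} (hc : ∀ m, m ∉ Finset.Icc 1 N → c m = 0)
    (hsum : ∑ m ∈ Finset.Icc 1 N, m * c m = n)
    (s : Finset (Equiv.Perm (Fin n))) (hs : ∀ σ, σ ∈ s ↔ ∀ m, cycleCount m σ = c m) :
    ∑ σ ∈ s, ewensWeight ϑ n σ =
      n.factorial / (∏ i ∈ Finset.range n, (ϑ + i)) *
        ∏ m ∈ Finset.Icc 1 N, (ϑ / m) ^ c m / (c m).factorial := by
  have hw : ∀ σ ∈ s, ewensWeight ϑ n σ =
      (∏ m ∈ Finset.Icc 1 N, ϑ ^ c m) / ∏ i ∈ Finset.range n, (ϑ + i) := by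
    intro σ hσ
    rw [ewensWeight]
    congr 1
    rw [← Finset.prod_subset (Finset.Icc_subset_Icc_right hNn)]
    · exact Finset.prod_congr rfl fun m _ => by rw [(hs σ).1 hσ m]
    · intro m _ hm
      rw [(hs σ).1 hσ m, hc m hm, pow_zero]
  rw [Finset.sum_congr rfl hw, Finset.sum_const, nsmul_eq_mul,
    ← card_cycleCount_eq_mul hN hc hsum s hs]
  simp only [div_pow]
  push_cast
  simp only [Finset.prod_div_distrib, Finset.prod_mul_distrib]
  have h1 : (∏ m ∈ Finset.Icc 1 N, (m : ℝ) ^ c m) ≠ 0 :=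
    Finset.prod_ne_zero_iff.2 fun m hm => pow_ne_zero _ (by
      have := (Finset.mem_Icc.1 hm).1
      positivity)
  have h2 : (∏ m ∈ Finset.Icc 1 N, ((c m).factorial : ℝ)) ≠ 0 :=
    Finset.prod_ne_zero_iff.2 fun m _ => by positivity
  field_simp

/-! ### Blocks of independent Poisson variables -/

/-- The law of independent Poisson variables `Y_{s+1}, …, Y_{s+k}` with `E[Y_m] = μ_m`; the
coordinate `j : Fin k` stands for the index `s + j + 1`. -/
def blockLaw (μ : ℕ → ℝ) (s k : ℕ) : Measure (Fin k → ℕ) :=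
  Measure.pi fun j => poissonMeasure (μ (s + j + 1)).toNNReal

/-- The number of points covered by a block of cycles: `∑ m * y_m` over `s < m ≤ s + k`, where
the coordinate `j : Fin k` of `y` stands for `m = s + j + 1`. -/
def blockSize (s k : ℕ) (y : Fin k → ℕ) : ℕ := ∑ j, (s + j + 1) * y j

instance (μ : ℕ → ℝ) (s k : ℕ) : IsProbabilityMeasure (blockLaw μ s k) := by
  unfold blockLaw; infer_instance

theorem le_blockSize {s k : ℕ} (y : Fin k → ℕ) (j : Fin k) : y j ≤ blockSize s k y :=
  le_trans (Nat.le_mul_of_pos_left _ (by omega))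
    (Finset.single_le_sum (f := fun j : Fin k => (s + j + 1) * y j) (fun _ _ => Nat.zero_le _)
      (Finset.mem_univ j))

/-- The law of `(Y_1, …, Y_N)`, cut into the blocks `(Y_1, …, Y_b)` and `(Y_{b+1}, …, Y_{b+d})`. -/
abbrev twoBlockLaw (μ : ℕ → ℝ) (b d : ℕ) : Measure ((Fin b → ℕ) × (Fin d → ℕ)) :=
  (blockLaw μ 0 b).prod (blockLaw μ b d)

/-- The total size of two consecutive blocks. -/
def twoBlockSize (b d : ℕ) (ω : (Fin b → ℕ) × (Fin d → ℕ)) : ℕ :=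
  blockSize 0 b ω.1 + blockSize b d ω.2

/-- The block coordinates as one sequence indexed by the cycle length, zero outside `[1, b + d]`. -/
def joinCounts (b d : ℕ) (ω : (Fin b → ℕ) × (Fin d → ℕ)) (m : ℕ) : ℕ :=
  if h : 1 ≤ m ∧ m ≤ b then ω.1 ⟨m - 1, by omega⟩
  else if h : b < m ∧ m ≤ b + d then ω.2 ⟨m - b - 1, by omega⟩ else 0

theorem joinCounts_fst {b d : ℕ} (ω : (Fin b → ℕ) × (Fin d → ℕ)) (j : Fin b) :
    joinCounts b d ω (j + 1) = ω.1 j := by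
  simp [joinCounts, show (j : ℕ) + 1 ≤ b from j.2]

theorem joinCounts_snd {b d : ℕ} (ω : (Fin b → ℕ) × (Fin d → ℕ)) (j : Fin d) :
    joinCounts b d ω (b + j + 1) = ω.2 j := by
  have := j.2
  rw [joinCounts, dif_neg (by omega), dif_pos (by omega)]
  exact congrArg ω.2 (Fin.ext (by simp only; omega))

theorem joinCounts_eq_zero {b d : ℕ} (ω : (Fin b → ℕ) × (Fin d → ℕ)) (m : ℕ)
    (hm : m ∉ Finset.Icc 1 (b + d)) : joinCounts b d ω m = 0 := by
  rw [Finset.mem_Icc] at hm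
  rw [joinCounts, dif_neg (by omega), dif_neg (by omega)]

@[to_additive]
theorem prod_Icc_add {M : Type*} [CommMonoid M] (f : ℕ → M) (b d : ℕ) :
    ∏ m ∈ Finset.Icc 1 (b + d), f m =
      (∏ j : Fin b, f (0 + j + 1)) * ∏ j : Fin d, f (b + j + 1) := by
  rw [Fin.prod_univ_eq_prod_range (fun j => f (0 + j + 1)),
    Fin.prod_univ_eq_prod_range (fun j => f (b + j + 1)), ← Finset.Ico_add_one_right_eq_Icc,
    Finset.prod_Ico_eq_prod_range, Nat.add_sub_cancel, Finset.prod_range_add]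
  congr 1 <;> exact Finset.prod_congr rfl fun j _ => congrArg f (by omega)

theorem sum_mul_joinCounts (b d : ℕ) (ω : (Fin b → ℕ) × (Fin d → ℕ)) :
    ∑ m ∈ Finset.Icc 1 (b + d), m * joinCounts b d ω m = twoBlockSize b d ω := by
  rw [sum_Icc_add, twoBlockSize, blockSize, blockSize]
  congr 1
  · exact Finset.sum_congr rfl fun j _ => by rw [zero_add, joinCounts_fst]
  · exact Finset.sum_congr rfl fun j _ => by rw [joinCounts_snd]

theorem twoBlockLaw_real_singleton {μ : ℕ → ℝ} (hμ : ∀ m, 0 ≤ μ m) (b d : ℕ)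
    (ω : (Fin b → ℕ) × (Fin d → ℕ)) :
    (twoBlockLaw μ b d).real {ω} = ∏ m ∈ Finset.Icc 1 (b + d),
      (Real.exp (-μ m) * μ m ^ joinCounts b d ω m / (joinCounts b d ω m).factorial) := by
  rw [← Set.singleton_prod_singleton, measureReal_prod_prod, prod_Icc_add]
  congr 1
  · rw [measureReal_def, blockLaw, Measure.pi_singleton, ENNReal.toReal_prod]
    refine Finset.prod_congr rfl fun j _ => ?_
    rw [← measureReal_def, poissonMeasure_real_singleton, Real.coe_toNNReal _ (hμ _)]
    simp only [zero_add, joinCounts_fst]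
  · rw [measureReal_def, blockLaw, Measure.pi_singleton, ENNReal.toReal_prod]
    refine Finset.prod_congr rfl fun j _ => ?_
    rw [← measureReal_def, poissonMeasure_real_singleton, Real.coe_toNNReal _ (hμ _)]
    simp only [joinCounts_snd]

/-- For the tilted means `μ_m = ϑ x^m / m`, the parameter `x` enters the Poisson weights only
through the total size. -/
theorem twoBlockLaw_real_singleton_tilted {ϑ x : ℝ} (hϑ : 0 ≤ ϑ) (hx : 0 ≤ x) (b d : ℕ)
    (ω : (Fin b → ℕ) × (Fin d → ℕ)) :
    (twoBlockLaw (fun m => ϑ * x ^ m / m) b d).real {ω} =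
      Real.exp (-∑ m ∈ Finset.Icc 1 (b + d), ϑ * x ^ m / m) * x ^ twoBlockSize b d ω *
        ∏ m ∈ Finset.Icc 1 (b + d),
          (ϑ / m) ^ joinCounts b d ω m / (joinCounts b d ω m).factorial := by
  rw [twoBlockLaw_real_singleton (fun m => by positivity), ← sum_mul_joinCounts,
    ← Finset.prod_pow_eq_pow_sum, ← Finset.sum_neg_distrib, Real.exp_sum,
    ← Finset.prod_mul_distrib, ← Finset.prod_mul_distrib]
  refine Finset.prod_congr rfl fun m _ => ?_
  rw [mul_div_assoc, mul_assoc, show ϑ * x ^ m / m = x ^ m * (ϑ / m) by ring, mul_pow, pow_mul]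
  ring

theorem hasSum_poissonMean (r : NNReal) :
    HasSum (fun k : ℕ => Real.exp (-r) * (r : ℝ) ^ k / k.factorial * k) r := by
  rw [← hasSum_nat_add_iff' 1]
  simp only [Finset.sum_range_one, Nat.cast_zero, mul_zero, sub_zero]
  convert! (hasSum_one_poissonMeasure r).mul_left (r : ℝ) using 1
  · ext k
    rw [Nat.factorial_succ]
    push_cast
    field_simp
    ring
  · rw [mul_one]

theorem integrable_natCast_poissonMeasure (r : NNReal) :
    Integrable (fun k : ℕ => (k : ℝ)) (poissonMeasure r) := by
  rw [integrable_poissonMeasure_iff]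
  simpa using (hasSum_poissonMean r).summable

theorem integral_natCast_poissonMeasure (r : NNReal) :
    ∫ k : ℕ, (k : ℝ) ∂poissonMeasure r = r := by
  rw [integral_poissonMeasure]
  simpa using (hasSum_poissonMean r).tsum_eq

theorem integrable_coord_blockLaw (μ : ℕ → ℝ) (s k : ℕ) (j : Fin k) :
    Integrable (fun y : Fin k → ℕ => (y j : ℝ)) (blockLaw μ s k) :=
  (measurePreserving_eval (fun j : Fin k => poissonMeasure (μ (s + j + 1)).toNNReal) j
    |>.integrable_comp_of_integrable (integrable_natCast_poissonMeasure _))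

theorem integral_coord_blockLaw {μ : ℕ → ℝ} (hμ : ∀ m, 0 ≤ μ m) (s k : ℕ) (j : Fin k) :
    ∫ y : Fin k → ℕ, (y j : ℝ) ∂blockLaw μ s k = μ (s + j + 1) := by
  have h := measurePreserving_eval (fun j : Fin k => poissonMeasure (μ (s + j + 1)).toNNReal) j
  have h2 := integral_map (μ := blockLaw μ s k) h.measurable.aemeasurable
    (f := fun i : ℕ => (i : ℝ)) (by fun_prop)
  rw [blockLaw, h.map_eq, integral_natCast_poissonMeasure, Real.coe_toNNReal _ (hμ _)] at h2
  exact h2.symm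

theorem integrable_blockSize (μ : ℕ → ℝ) (s k : ℕ) :
    Integrable (fun y => (blockSize s k y : ℝ)) (blockLaw μ s k) := by
  simp only [blockSize, Nat.cast_sum, Nat.cast_mul]
  exact integrable_finsetSum _ fun j _ => (integrable_coord_blockLaw μ s k j).const_mul _

theorem integral_blockSize {μ : ℕ → ℝ} (hμ : ∀ m, 0 ≤ μ m) (s k : ℕ) :
    ∫ y, (blockSize s k y : ℝ) ∂blockLaw μ s k =
      ∑ j : Fin k, ((s + j + 1 : ℕ) : ℝ) * μ (s + j + 1) := by
  simp only [blockSize, Nat.cast_sum, Nat.cast_mul]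
  rw [integral_finsetSum _ fun j _ => (integrable_coord_blockLaw μ s k j).const_mul _]
  exact Finset.sum_congr rfl fun j _ => by rw [integral_const_mul, integral_coord_blockLaw hμ]

/-! ### The conditioning relation -/

theorem finite_twoBlockSize_eq (b d n : ℕ) :
    {ω : (Fin b → ℕ) × (Fin d → ℕ) | twoBlockSize b d ω = n}.Finite := by
  refine ((Set.finite_Iic (fun _ : Fin b => n)).prod
    (Set.finite_Iic (fun _ : Fin d => n))).subset ?_
  rintro ω rfl
  exact ⟨fun j => (le_blockSize ω.1 j).trans (Nat.le_add_right _ _),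
    fun j => (le_blockSize ω.2 j).trans (Nat.le_add_left _ _)⟩

theorem ewensWeight_nonneg {ϑ : ℝ} (hϑ : 0 ≤ ϑ) (n : ℕ) (σ : Equiv.Perm (Fin n)) :
    0 ≤ ewensWeight ϑ n σ := by
  unfold ewensWeight; positivity

instance (ϑ : ℝ) (n : ℕ) : IsFiniteMeasure (ewensMeasure ϑ n) := by
  refine ⟨?_⟩
  rw [ewensMeasure, Measure.finsetSum_apply]
  exact ENNReal.sum_lt_top.2 fun σ _ => by simp

open Classical in
theorem ewensMeasure_real_apply {ϑ : ℝ} (hϑ : 0 ≤ ϑ) (n : ℕ) (E : Set (Equiv.Perm (Fin n))) :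
    (ewensMeasure ϑ n).real E = ∑ σ ∈ Finset.univ.filter (· ∈ E), ewensWeight ϑ n σ := by
  rw [measureReal_def, ewensMeasure, Measure.finsetSum_apply,
    ENNReal.toReal_sum fun σ _ => by
      simpa using ENNReal.mul_ne_top ENNReal.ofReal_ne_top (measure_ne_top (Measure.dirac σ) E),
    Finset.sum_filter]
  refine Finset.sum_congr rfl fun σ _ => ?_
  rw [Measure.smul_apply, Measure.dirac_apply' _ (by trivial), Set.indicator_apply]
  split_ifs <;> simp [ewensWeight_nonneg hϑ]

theorem cycleCount_zero {n : ℕ} (σ : Equiv.Perm (Fin n)) : cycleCount 0 σ = 0 :=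
  Multiset.count_eq_zero.2 fun h => (σ.partition.parts_pos h).ne' rfl

theorem sum_mul_cycleCount {n N : ℕ} {σ : Equiv.Perm (Fin n)}
    (hσ : ∀ m, N < m → cycleCount m σ = 0) :
    ∑ m ∈ Finset.Icc 1 N, m * cycleCount m σ = n := by
  have h := σ.partition.parts_sum
  rw [Finset.sum_multiset_count_of_subset _ (Finset.Icc 1 N)] at h
  · refine Eq.trans ?_ (h.trans (Fintype.card_fin n))
    exact Finset.sum_congr rfl fun m _ => by rw [cycleCount, smul_eq_mul, mul_comm]
  · intro m hm
    rw [Multiset.mem_toFinset] at hm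
    refine Finset.mem_Icc.2 ⟨σ.partition.parts_pos hm, ?_⟩
    by_contra! h'
    exact Multiset.count_eq_zero.1 (hσ m h') hm

/-- The conditioning relation: up to a constant factor, the Ewens weight of the permutations with
cycle lengths at most `b + d` whose small cycle counts lie in `A` is the probability that
independent Poisson variables of tilted means fill `n` points with the small counts in `A`. -/
theorem exists_ewensMeasure_real_eq_mul_twoBlockLaw {ϑ x : ℝ} (hϑ : 0 < ϑ) (hx : 0 < x)
    {n b d : ℕ} (hN : 1 ≤ b + d) (hNn : b + d ≤ n) {a : ℝ} (ha : 0 ≤ a) (hfl : ⌊a⌋₊ = b + d) :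
    ∃ K : ℝ, 0 < K ∧ ∀ A : Set (Fin b → ℕ),
      (ewensMeasure ϑ n).real (shortCyclePerms n a ∩
          {σ | (fun j : Fin b => cycleCount (j.val + 1) σ) ∈ A}) =
        K * (twoBlockLaw (fun m => ϑ * x ^ m / m) b d).real
          {ω | ω.1 ∈ A ∧ twoBlockSize b d ω = n} := by
  classical
  have hshort : ∀ σ, σ ∈ shortCyclePerms n a ↔ ∀ m, b + d < m → cycleCount m σ = 0 := by
    intro σ
    simp only [shortCyclePerms, Set.mem_ofPred_eq, ← hfl, Nat.floor_lt ha]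
  refine ⟨n.factorial / (∏ i ∈ Finset.range n, (ϑ + i)) *
    (Real.exp (∑ m ∈ Finset.Icc 1 (b + d), ϑ * x ^ m / m) / x ^ n),
    mul_pos (div_pos (by positivity) (Finset.prod_pos fun i _ => by positivity)) (by positivity),
    fun A => ?_⟩
  have hfin : {ω : (Fin b → ℕ) × (Fin d → ℕ) | ω.1 ∈ A ∧ twoBlockSize b d ω = n}.Finite :=
    (finite_twoBlockSize_eq b d n).subset fun ω h => h.2
  set g : Equiv.Perm (Fin n) → (Fin b → ℕ) × (Fin d → ℕ) := fun σ =>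
    (fun j => cycleCount (j.val + 1) σ, fun j => cycleCount (b + j.val + 1) σ) with hg
  have hgc : ∀ σ ∈ shortCyclePerms n a, ∀ m, cycleCount m σ = joinCounts b d (g σ) m := by
    intro σ hσ m
    by_cases h1 : 1 ≤ m ∧ m ≤ b
    · obtain ⟨j, rfl⟩ : ∃ j : Fin b, m = j + 1 := ⟨⟨m - 1, by omega⟩, by simp only; omega⟩
      rw [joinCounts_fst]
    · by_cases h2 : b < m ∧ m ≤ b + d
      · obtain ⟨j, rfl⟩ : ∃ j : Fin d, m = b + j + 1 :=
          ⟨⟨m - b - 1, by omega⟩, by simp only; omega⟩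
        rw [joinCounts_snd]
      · rw [joinCounts_eq_zero _ _ (by rw [Finset.mem_Icc]; omega)]
        rcases Nat.eq_zero_or_pos m with rfl | hm
        · exact cycleCount_zero σ
        · exact (hshort σ).1 hσ m (by omega)
  have hsum : (twoBlockLaw (fun m => ϑ * x ^ m / m) b d).real
      {ω | ω.1 ∈ A ∧ twoBlockSize b d ω = n} =
      ∑ ω ∈ hfin.toFinset, (twoBlockLaw (fun m => ϑ * x ^ m / m) b d).real {ω} := by
    rw [sum_measureReal_singleton, hfin.coe_toFinset]
  rw [ewensMeasure_real_apply hϑ.le,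
    ← Finset.sum_fiberwise_of_maps_to (t := hfin.toFinset) (g := g), hsum, Finset.mul_sum]
  · refine Finset.sum_congr rfl fun ω hω => ?_
    rw [hfin.mem_toFinset] at hω
    rw [twoBlockLaw_real_singleton_tilted hϑ.le hx.le, hω.2,
      sum_ewensWeight_cycleCount_eq hN hNn (joinCounts_eq_zero ω)
        ((sum_mul_joinCounts b d ω).trans hω.2), Real.exp_neg]
    · have := Real.exp_pos (∑ m ∈ Finset.Icc 1 (b + d), ϑ * x ^ m / m)
      field_simp
    · intro σ
      simp only [Finset.mem_filter, Finset.mem_univ, true_and, Set.mem_inter_iff]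
      constructor
      · rintro ⟨⟨h1, -⟩, rfl⟩
        exact hgc σ h1
      · intro h
        have hgσ : g σ = ω := Prod.ext (funext fun j => (h _).trans (joinCounts_fst ω j))
          (funext fun j => (h _).trans (joinCounts_snd ω j))
        refine ⟨⟨(hshort σ).2 fun m hm => ?_, ?_⟩, hgσ⟩
        · rw [h, joinCounts_eq_zero _ _ (by rw [Finset.mem_Icc]; omega)]
        · have := hω.1
          rw [← hgσ] at this
          exact this
  · intro σ hσ
    simp only [Finset.mem_filter, Finset.mem_univ, true_and, Set.mem_inter_iff] at hσ
    rw [hfin.mem_toFinset]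
    refine ⟨hσ.2, ?_⟩
    rw [← sum_mul_joinCounts, ← sum_mul_cycleCount ((hshort σ).1 hσ.1)]
    exact Finset.sum_congr rfl fun m _ => by rw [hgc σ hσ.1 m]

/-! ### Total variation and local regularity -/

/-- If the atoms of the law of `g` are Lipschitz in the position, then conditioning an independent
variable `f` on `f + g = n` hardly changes its law: the event `f + g = n` is nearly independent of
every event that concerns the first coordinate only. -/
theorem abs_prod_real_sub_mul_le {Ω₁ Ω₂ : Type*} [MeasurableSpace Ω₁] [MeasurableSpace Ω₂]
    (π : Measure Ω₁) (ρ : Measure Ω₂) [IsProbabilityMeasure π] [IsProbabilityMeasure ρ]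
    {f : Ω₁ → ℕ} {g : Ω₂ → ℕ} (hf : Measurable f) (hg : Measurable g)
    (hfi : Integrable (fun y => (f y : ℝ)) π) {n : ℕ} {Λ : ℝ}
    (hΛ : ∀ k : ℕ, |ρ.real {z | k + g z = n} - ρ.real {z | g z = n}| ≤ Λ * k)
    {A : Set Ω₁} (hA : MeasurableSet A) :
    |(π.prod ρ).real {ω | ω.1 ∈ A ∧ f ω.1 + g ω.2 = n} -
      π.real A * (π.prod ρ).real {ω | f ω.1 + g ω.2 = n}| ≤ 2 * Λ * ∫ y, (f y : ℝ) ∂π := by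
  set p : ℕ → ℝ := fun k => ρ.real {z | k + g z = n} with hp
  have hp01 : ∀ k, p k ≤ 1 := fun k => measureReal_le_one
  have hpm : Measurable fun y => p (f y) :=
    (measurable_from_nat (f := p)).comp hf
  have hpi : Integrable (fun y => p (f y)) π :=
    Integrable.of_bound hpm.aestronglyMeasurable 1 (Eventually.of_forall fun y => by
      rw [Real.norm_of_nonneg measureReal_nonneg]; exact hp01 _)
  have hset : ∀ B : Set Ω₁, MeasurableSet B →
      (π.prod ρ).real {ω | ω.1 ∈ B ∧ f ω.1 + g ω.2 = n} = ∫ y in B, p (f y) ∂π := by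
    intro B hB
    have hm : MeasurableSet {ω : Ω₁ × Ω₂ | ω.1 ∈ B ∧ f ω.1 + g ω.2 = n} :=
      (measurable_fst hB).inter
        (measurableSet_eq_fun ((hf.comp measurable_fst).add (hg.comp measurable_snd))
          measurable_const)
    rw [measureReal_def, Measure.prod_apply hm, ← integral_toReal, ← integral_indicator hB]
    · refine integral_congr_ae (Eventually.of_forall fun y => ?_)
      by_cases hy : y ∈ B
      · simp [hy, hp, measureReal_def]
      · simp [hy]
    · exact (measurable_measure_prodMk_left hm).aemeasurable
    · exact Eventually.of_forall fun y => measure_lt_top _ _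
  have hE := hset A hA
  have hU : (π.prod ρ).real {ω | f ω.1 + g ω.2 = n} = ∫ y, p (f y) ∂π := by
    simpa using hset Set.univ MeasurableSet.univ
  have hfin : ∀ B : Set Ω₁, MeasurableSet B →
      |(∫ y in B, p (f y) ∂π) - π.real B * p 0| ≤ Λ * ∫ y, (f y : ℝ) ∂π := by
    intro B hB
    have h1 : (∫ y in B, p (f y) ∂π) - π.real B * p 0 = ∫ y in B, (p (f y) - p 0) ∂π := by
      rw [integral_sub hpi.integrableOn (integrable_const _), setIntegral_const, smul_eq_mul]
    have hi : Integrable (fun y => |p (f y) - p 0|) π := (hpi.sub (integrable_const _)).abs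
    rw [h1, ← integral_const_mul]
    calc |∫ y in B, (p (f y) - p 0) ∂π| ≤ ∫ y in B, |p (f y) - p 0| ∂π :=
          abs_integral_le_integral_abs
      _ ≤ ∫ y, |p (f y) - p 0| ∂π :=
          setIntegral_le_integral hi (Eventually.of_forall fun y => abs_nonneg _)
      _ ≤ ∫ y, Λ * (f y : ℝ) ∂π := integral_mono hi (hfi.const_mul _) fun y => by
          simpa [hp] using hΛ (f y)
  have h1 := hfin A hA
  have h2 := hfin Set.univ MeasurableSet.univ
  rw [setIntegral_univ, probReal_univ, one_mul] at h2
  rw [hE, hU]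
  have hπ0 : 0 ≤ π.real A := measureReal_nonneg
  have hπ1 : π.real A ≤ 1 := measureReal_le_one
  have h3 : |π.real A * ((∫ y, p (f y) ∂π) - p 0)| ≤ Λ * ∫ y, (f y : ℝ) ∂π := by
    rw [abs_mul, abs_of_nonneg hπ0]
    exact (mul_le_of_le_one_left (abs_nonneg _) hπ1).trans h2
  calc |(∫ y in A, p (f y) ∂π) - π.real A * ∫ y, p (f y) ∂π|
      = |((∫ y in A, p (f y) ∂π) - π.real A * p 0)
          - π.real A * ((∫ y, p (f y) ∂π) - p 0)| := by congr 1; ring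
    _ ≤ _ := (abs_sub _ _).trans (by linarith)

theorem measurable_blockSize (s k : ℕ) : Measurable (blockSize s k) := by
  unfold blockSize; fun_prop

theorem measurable_twoBlockSize (b d : ℕ) : Measurable (twoBlockSize b d) :=
  ((measurable_blockSize 0 b).comp measurable_fst).add
    ((measurable_blockSize b d).comp measurable_snd)

theorem cycleCountLaw_real_apply {ϑ x : ℝ} (hϑ : 0 < ϑ) (hx : 0 < x)
    {n b d : ℕ} (hN : 1 ≤ b + d) (hNn : b + d ≤ n) {a : ℝ} (ha : 0 ≤ a) (hfl : ⌊a⌋₊ = b + d)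
    {A : Set (Fin b → ℕ)} (hA : MeasurableSet A) :
    (cycleCountLaw ϑ n a b).real A =
      (twoBlockLaw (fun m => ϑ * x ^ m / m) b d).real {ω | ω.1 ∈ A ∧ twoBlockSize b d ω = n} /
        (twoBlockLaw (fun m => ϑ * x ^ m / m) b d).real {ω | twoBlockSize b d ω = n} := by
  obtain ⟨K, hK, h⟩ := exists_ewensMeasure_real_eq_mul_twoBlockLaw hϑ hx hN hNn ha hfl
  have hU := h Set.univ
  simp only [Set.mem_univ, true_and, Set.ofPred_true, Set.inter_univ] at hU
  have hcond : (restrictedEwens ϑ n a).real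
      ((fun σ (j : Fin b) => cycleCount (j.val + 1) σ) ⁻¹' A) =
      ((ewensMeasure ϑ n).real (shortCyclePerms n a))⁻¹ * (ewensMeasure ϑ n).real
        (shortCyclePerms n a ∩ {σ | (fun j : Fin b => cycleCount (j.val + 1) σ) ∈ A}) := by
    rw [restrictedEwens, measureReal_def, cond_apply (by trivial), ENNReal.toReal_mul,
      ENNReal.toReal_inv]
    rfl
  rw [cycleCountLaw, map_measureReal_apply measurable_from_top hA, hcond, hU, h A, mul_inv]
  field_simp

/-- Total variation bound from a Lipschitz bound `Λ` for the law of the size of the long block and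
a lower bound `q` for the probability that both blocks together fill `n` points. -/
theorem tvDist_cycleCountLaw_le {ϑ x : ℝ} (hϑ : 0 < ϑ) (hx : 0 < x)
    {n b d : ℕ} (hN : 1 ≤ b + d) (hNn : b + d ≤ n) {a : ℝ} (ha : 0 ≤ a) (hfl : ⌊a⌋₊ = b + d)
    {Λ q : ℝ} (hq : 0 < q)
    (hΛ : ∀ k : ℕ, |(blockLaw (fun m => ϑ * x ^ m / m) b d).real {z | k + blockSize b d z = n} -
      (blockLaw (fun m => ϑ * x ^ m / m) b d).real {z | blockSize b d z = n}| ≤ Λ * k)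
    (hqle : q ≤ (twoBlockLaw (fun m => ϑ * x ^ m / m) b d).real {ω | twoBlockSize b d ω = n}) :
    tvDist (cycleCountLaw ϑ n a b) (blockLaw (fun m => ϑ * x ^ m / m) 0 b) ≤
      2 * Λ * (ϑ * ∑ j ∈ Finset.Icc 1 b, x ^ j) / q := by
  have hmean : ∫ y, (blockSize 0 b y : ℝ) ∂blockLaw (fun m => ϑ * x ^ m / m) 0 b =
      ϑ * ∑ j ∈ Finset.Icc 1 b, x ^ j := by
    rw [integral_blockSize (fun m => by positivity), Finset.mul_sum]
    have := sum_Icc_add (fun m => ϑ * x ^ m) b 0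
    simp only [add_zero, Finset.univ_eq_empty, Finset.sum_empty] at this
    rw [this]
    exact Finset.sum_congr rfl fun j _ => by field_simp
  refine ciSup_le fun ⟨A, hA⟩ => ?_
  have key := abs_prod_real_sub_mul_le (blockLaw (fun m => ϑ * x ^ m / m) 0 b)
    (blockLaw (fun m => ϑ * x ^ m / m) b d) (measurable_blockSize 0 b) (measurable_blockSize b d)
    (integrable_blockSize _ 0 b) hΛ hA
  rw [hmean] at key
  rw [cycleCountLaw_real_apply hϑ hx hN hNn ha hfl hA]
  simp only [twoBlockSize] at hqle ⊢
  set P := (twoBlockLaw (fun m => ϑ * x ^ m / m) b d).real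
    {ω | blockSize 0 b ω.1 + blockSize b d ω.2 = n}
  have hP : 0 < P := hq.trans_le hqle
  rw [div_sub' hP.ne', abs_div, abs_of_pos hP, mul_comm P]
  exact div_le_div₀ ((abs_nonneg _).trans key) key hq hqle

/-! ### Fourier inversion -/

theorem integral_exp_int_mul_I (m : ℤ) :
    ∫ t in (-Real.pi)..Real.pi, Complex.exp (m * t * Complex.I) =
      if m = 0 then 2 * (Real.pi : ℂ) else 0 := by
  split_ifs with hm
  · simp [hm]
    ring
  · have hc : (m : ℂ) * Complex.I ≠ 0 := mul_ne_zero (by exact_mod_cast hm) Complex.I_ne_zero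
    have h := integral_exp_mul_complex (a := -Real.pi) (b := Real.pi) hc
    have hfun : ∀ t : ℝ, (m : ℂ) * t * Complex.I = m * Complex.I * t := fun t => by ring
    simp only [hfun]
    rw [h, div_eq_zero_iff]
    left
    have : (m : ℂ) * Complex.I * (Real.pi : ℝ) =
        m * Complex.I * ((-Real.pi : ℝ) : ℂ) + m * (2 * Real.pi * Complex.I) := by
      push_cast; ring
    rw [this, Complex.exp_periodic.int_mul m, sub_self]

/-- The characteristic function of an integer-valued random variable. -/
def natCharFun {Ω : Type*} [MeasurableSpace Ω] (P : Measure Ω) (X : Ω → ℕ) (t : ℝ) : ℂ :=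
  ∫ ω, Complex.exp (X ω * t * Complex.I) ∂P

/-- Fourier inversion for the atoms of an integer-valued random variable. -/
theorem two_pi_mul_real_eq_integral_natCharFun {Ω : Type*} [MeasurableSpace Ω] (P : Measure Ω)
    [IsProbabilityMeasure P] {X : Ω → ℕ} (hX : Measurable X) (k n : ℕ) :
    ((2 * Real.pi * P.real {ω | k + X ω = n} : ℝ) : ℂ) =
      ∫ t in (-Real.pi)..Real.pi,
        Complex.exp (((k : ℝ) - n : ℝ) * t * Complex.I) * natCharFun P X t := by
  have hint : Integrable (Function.uncurry fun (t : ℝ) (ω : Ω) =>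
      Complex.exp (((k : ℝ) - n : ℝ) * t * Complex.I) * Complex.exp (X ω * t * Complex.I))
      ((volume.restrict (Set.uIoc (-Real.pi) Real.pi)).prod P) := by
    have : IsFiniteMeasure (volume.restrict (Set.uIoc (-Real.pi) Real.pi)) :=
      ⟨by rw [Measure.restrict_apply_univ, Set.uIoc]; exact measure_Ioc_lt_top⟩
    refine Integrable.of_bound (C := 1) ?_ (Eventually.of_forall fun z => ?_)
    · have h1 : Measurable fun z : ℝ × Ω => (X z.2 : ℂ) :=
        (measurable_from_nat (f := fun m : ℕ => (m : ℂ))).comp (hX.comp measurable_snd)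
      exact Measurable.aestronglyMeasurable (by
        unfold Function.uncurry; fun_prop)
    · simp only [Function.uncurry, norm_mul]
      rw [show (((k : ℝ) - n : ℝ) : ℂ) * z.1 * Complex.I =
          (((k : ℝ) - n) * z.1 : ℝ) * Complex.I by push_cast; ring,
        show (X z.2 : ℂ) * z.1 * Complex.I = (X z.2 * z.1 : ℝ) * Complex.I by push_cast; ring,
        Complex.norm_exp_ofReal_mul_I, Complex.norm_exp_ofReal_mul_I, mul_one]
  have hswap := intervalIntegral_integral_swap hint
  calc ((2 * Real.pi * P.real {ω | k + X ω = n} : ℝ) : ℂ)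
      = ∫ ω, (if k + X ω = n then 2 * (Real.pi : ℂ) else 0) ∂P := by
        have hm : MeasurableSet {ω | k + X ω = n} :=
          measurableSet_eq_fun (measurable_const.add hX) measurable_const
        have := integral_indicator_const (μ := P) (2 * (Real.pi : ℂ)) hm
        simp only [Set.indicator_apply, Set.mem_ofPred_eq] at this
        rw [this, Complex.real_smul]
        push_cast; ring
    _ = ∫ ω, (∫ t in (-Real.pi)..Real.pi, Complex.exp (((k : ℝ) - n : ℝ) * t * Complex.I) *
          Complex.exp (X ω * t * Complex.I)) ∂P := by
        congr 1
        ext ω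
        have h := integral_exp_int_mul_I ((k : ℤ) - n + X ω)
        simp only [show ((k : ℤ) - n + X ω = 0) ↔ k + X ω = n by omega] at h
        rw [← h]
        congr 1
        ext t
        rw [← Complex.exp_add]
        push_cast; ring_nf
    _ = _ := by
        rw [← hswap]
        simp only [natCharFun, integral_const_mul]

/-- The atoms of an integer-valued law are Lipschitz with constant `(2π)⁻¹ ∫ |t| |φ(t)| dt`, here
with a continuous majorant `h` in place of the modulus of the characteristic function `φ`. -/
theorem abs_real_sub_real_le {Ω : Type*} [MeasurableSpace Ω] (P : Measure Ω)
    [IsProbabilityMeasure P] {X : Ω → ℕ} (hX : Measurable X) {h : ℝ → ℝ}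
    (hh : Continuous h) (hle : ∀ t, |t| ≤ Real.pi → ‖natCharFun P X t‖ ≤ h t)
    (hcont : Continuous (natCharFun P X)) (k n : ℕ) :
    |P.real {ω | k + X ω = n} - P.real {ω | X ω = n}| ≤
      ((2 * Real.pi)⁻¹ * ∫ t in (-Real.pi)..Real.pi, |t| * h t) * k := by
  have hpi := Real.pi_pos
  have h1 := two_pi_mul_real_eq_integral_natCharFun P hX k n
  have h0 := two_pi_mul_real_eq_integral_natCharFun P hX 0 n
  simp only [zero_add] at h0
  have hsub : ((2 * Real.pi * (P.real {ω | k + X ω = n} - P.real {ω | X ω = n}) : ℝ) : ℂ) =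
      ∫ t in (-Real.pi)..Real.pi,
        (Complex.exp (((k : ℝ) - n : ℝ) * t * Complex.I) -
          Complex.exp ((((0 : ℕ) : ℝ) - n : ℝ) * t * Complex.I)) * natCharFun P X t := by
    simp only [sub_mul _ _ (natCharFun P X _)]
    rw [intervalIntegral.integral_sub, ← h1, ← h0]
    · push_cast; ring
    · exact Continuous.intervalIntegrable (by fun_prop) _ _
    · exact Continuous.intervalIntegrable (by fun_prop) _ _
  have hbound : ‖∫ t in (-Real.pi)..Real.pi,
        (Complex.exp (((k : ℝ) - n : ℝ) * t * Complex.I) -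
          Complex.exp ((((0 : ℕ) : ℝ) - n : ℝ) * t * Complex.I)) * natCharFun P X t‖ ≤
      ∫ t in (-Real.pi)..Real.pi, k * (|t| * h t) := by
    refine intervalIntegral.norm_integral_le_of_norm_le (by linarith) ?_
      (Continuous.intervalIntegrable (by fun_prop) _ _)
    refine Eventually.of_forall fun t ht => ?_
    rw [norm_mul, ← mul_assoc]
    refine mul_le_mul ?_ (hle t (abs_le.2 ⟨ht.1.le, ht.2⟩)) (norm_nonneg _) (by positivity)
    have e1 : Complex.exp (((k : ℝ) - n : ℝ) * t * Complex.I) =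
        Complex.exp ((((0 : ℕ) : ℝ) - n : ℝ) * t * Complex.I) *
          Complex.exp (Complex.I * (k * t : ℝ)) := by
      rw [← Complex.exp_add]; push_cast; ring_nf
    rw [e1, ← mul_sub_one, norm_mul,
      show ((((0 : ℕ) : ℝ) - n : ℝ) : ℂ) * t * Complex.I =
          ((((0 : ℕ) : ℝ) - n) * t : ℝ) * Complex.I by push_cast; ring,
      Complex.norm_exp_ofReal_mul_I, one_mul]
    refine Real.norm_exp_I_mul_ofReal_sub_one_le.trans ?_
    rw [Real.norm_eq_abs, abs_mul, abs_of_nonneg (Nat.cast_nonneg k)]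
  rw [← hsub, Complex.norm_real, Real.norm_eq_abs, abs_mul, abs_of_pos (by positivity),
    intervalIntegral.integral_const_mul] at hbound
  rw [mul_assoc, mul_comm _ (k : ℝ), ← div_eq_inv_mul, le_div_iff₀ (by positivity)]
  linarith

theorem natCharFun_poissonMeasure (r : NNReal) (m : ℕ) (t : ℝ) :
    ∫ k : ℕ, Complex.exp ((m * k : ℕ) * t * Complex.I) ∂poissonMeasure r =
      Complex.exp (r * (Complex.exp (m * t * Complex.I) - 1)) := by
  have h := charFun_map_cast_poissonMeasure r (m * t)
  rw [charFun_apply, integral_map .of_discrete (by fun_prop)] at h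
  simp only [Real.inner_apply] at h
  push_cast at h ⊢
  rw [← h]
  congr 1
  ext k
  ring_nf

theorem natCharFun_blockSize {μ : ℕ → ℝ} (hμ : ∀ m, 0 ≤ μ m) (s k : ℕ) (t : ℝ) :
    natCharFun (blockLaw μ s k) (blockSize s k) t =
      Complex.exp (∑ j : Fin k, (μ (s + j + 1) : ℂ) *
        (Complex.exp ((s + j + 1 : ℕ) * t * Complex.I) - 1)) := by
  have hprod : ∀ y : Fin k → ℕ, Complex.exp (blockSize s k y * t * Complex.I) =
      ∏ j, Complex.exp (((s + j + 1) * y j : ℕ) * t * Complex.I) := by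
    intro y
    rw [← Complex.exp_sum, blockSize, Nat.cast_sum, Finset.sum_mul, Finset.sum_mul]
  rw [natCharFun]
  simp only [hprod]
  rw [blockLaw, integral_fintype_prod_eq_prod (f := fun (j : Fin k) (i : ℕ) =>
    Complex.exp (((s + j + 1) * i : ℕ) * t * Complex.I)), Complex.exp_sum]
  refine Finset.prod_congr rfl fun j _ => ?_
  rw [natCharFun_poissonMeasure]
  congr 2
  exact_mod_cast Real.coe_toNNReal _ (hμ _)

theorem natCharFun_twoBlockSize {μ : ℕ → ℝ} (hμ : ∀ m, 0 ≤ μ m) (b d : ℕ) (t : ℝ) :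
    natCharFun (twoBlockLaw μ b d) (twoBlockSize b d) t =
      Complex.exp (∑ m ∈ Finset.Icc 1 (b + d), (μ m : ℂ) *
        (Complex.exp (m * t * Complex.I) - 1)) := by
  have hprod : ∀ ω : (Fin b → ℕ) × (Fin d → ℕ),
      Complex.exp (twoBlockSize b d ω * t * Complex.I) =
        Complex.exp (blockSize 0 b ω.1 * t * Complex.I) *
          Complex.exp (blockSize b d ω.2 * t * Complex.I) := by
    intro ω
    rw [← Complex.exp_add, twoBlockSize]
    push_cast; ring_nf
  rw [natCharFun]
  simp only [hprod]
  rw [integral_prod_mul (fun y : Fin b → ℕ => Complex.exp (blockSize 0 b y * t * Complex.I))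
    (fun y : Fin d → ℕ => Complex.exp (blockSize b d y * t * Complex.I)), sum_Icc_add,
    Complex.exp_add]
  exact congrArg₂ (· * ·) (natCharFun_blockSize hμ 0 b t) (natCharFun_blockSize hμ b d t)

theorem re_mul_exp_sub_one (μ : ℝ) (m : ℕ) (t : ℝ) :
    ((μ : ℂ) * (Complex.exp (m * t * Complex.I) - 1)).re = -(μ * (1 - Real.cos (m * t))) := by
  rw [Complex.re_ofReal_mul, Complex.sub_re, Complex.one_re,
    show (m : ℂ) * t * Complex.I = (m * t : ℝ) * Complex.I by push_cast; ring,
    Complex.exp_ofReal_mul_I_re]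
  ring

theorem im_mul_exp_sub_one (μ : ℝ) (m : ℕ) (t : ℝ) :
    ((μ : ℂ) * (Complex.exp (m * t * Complex.I) - 1)).im = μ * Real.sin (m * t) := by
  rw [Complex.im_ofReal_mul, Complex.sub_im, Complex.one_im,
    show (m : ℂ) * t * Complex.I = (m * t : ℝ) * Complex.I by push_cast; ring,
    Complex.exp_ofReal_mul_I_im, sub_zero]

theorem norm_natCharFun_blockSize {μ : ℕ → ℝ} (hμ : ∀ m, 0 ≤ μ m) (s k : ℕ) (t : ℝ) :
    ‖natCharFun (blockLaw μ s k) (blockSize s k) t‖ =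
      Real.exp (-∑ j : Fin k, μ (s + j + 1) * (1 - Real.cos ((s + j + 1 : ℕ) * t))) := by
  rw [natCharFun_blockSize hμ, Complex.norm_exp, Complex.re_sum, ← Finset.sum_neg_distrib]
  simp only [re_mul_exp_sub_one]

theorem continuous_natCharFun_blockSize {μ : ℕ → ℝ} (hμ : ∀ m, 0 ≤ μ m) (s k : ℕ) :
    Continuous (natCharFun (blockLaw μ s k) (blockSize s k)) := by
  rw [funext (natCharFun_blockSize hμ s k)]
  fun_prop

/-- When the means are tuned so that the expected total size is `n`, Fourier inversion expresses
the probability of total size `n` by the centred characteristic function, whose phase is of third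
order in `t`. -/
theorem two_pi_mul_twoBlockLaw_real_eq_integral {μ : ℕ → ℝ} (hμ : ∀ m, 0 ≤ μ m) (b d n : ℕ)
    (hn : ∑ m ∈ Finset.Icc 1 (b + d), m * μ m = n) :
    2 * Real.pi * (twoBlockLaw μ b d).real {ω | twoBlockSize b d ω = n} =
      ∫ t in (-Real.pi)..Real.pi,
        Real.exp (-∑ m ∈ Finset.Icc 1 (b + d), μ m * (1 - Real.cos (m * t))) *
          Real.cos (∑ m ∈ Finset.Icc 1 (b + d), μ m * (Real.sin (m * t) - m * t)) := by
  have h := two_pi_mul_real_eq_integral_natCharFun (twoBlockLaw μ b d)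
    (measurable_twoBlockSize b d) 0 n
  simp only [zero_add] at h
  have hre := congrArg Complex.re h
  rw [Complex.ofReal_re] at hre
  rw [hre]
  have hcont : Continuous fun t : ℝ => Complex.exp ((((0 : ℕ) : ℝ) - n : ℝ) * t * Complex.I) *
      natCharFun (twoBlockLaw μ b d) (twoBlockSize b d) t := by
    simp only [natCharFun_twoBlockSize hμ]
    fun_prop
  have := Complex.reCLM.intervalIntegral_comp_comm
    (hcont.intervalIntegrable (μ := volume) (-Real.pi) Real.pi)
  rw [← Complex.reCLM_apply, ← this]
  congr 1
  ext t
  rw [Complex.reCLM_apply, natCharFun_twoBlockSize hμ, ← Complex.exp_add, Complex.exp_re,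
    Complex.add_re, Complex.add_im, Complex.re_sum, Complex.im_sum]
  simp only [re_mul_exp_sub_one, im_mul_exp_sub_one]
  rw [show ((((0 : ℕ) : ℝ) - n : ℝ) : ℂ) * t * Complex.I = (-(n * t) : ℝ) * Complex.I by
    push_cast; ring, Complex.re_ofReal_mul, Complex.im_ofReal_mul, Complex.I_re, Complex.I_im,
    mul_zero, zero_add, mul_one, Finset.sum_neg_distrib]
  congr 2
  rw [← hn, Finset.sum_mul, ← Finset.sum_neg_distrib, ← Finset.sum_add_distrib]
  exact Finset.sum_congr rfl fun m _ => by ring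

/-! ### Decay of the characteristic function -/

theorem two_mul_sin_mul_sum_cos (M L : ℕ) (t : ℝ) :
    2 * Real.sin (t / 2) * ∑ i ∈ Finset.range L, Real.cos ((M + i + 1 : ℕ) * t) =
      Real.sin ((M + L + 1 / 2) * t) - Real.sin ((M + 1 / 2) * t) := by
  induction L with
  | zero => simp
  | succ L ih =>
    rw [Finset.sum_range_succ, mul_add, ih,
      show (M + (L + 1 : ℕ) + 1 / 2 : ℝ) * t = (M + L + 1 : ℕ) * t + t / 2 by push_cast; ring,
      show (M + L + 1 / 2 : ℝ) * t = (M + L + 1 : ℕ) * t - t / 2 by push_cast; ring,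
      Real.sin_add, Real.sin_sub]
    ring

/-- Beyond the frequency `2π / L` at most half of a window of `L` cosines can align. -/
theorem half_le_sum_one_sub_cos {M L : ℕ} (hL : 0 < L) {t : ℝ} (ht : 2 * Real.pi / L ≤ |t|)
    (htpi : |t| ≤ Real.pi) :
    (L : ℝ) / 2 ≤ ∑ i ∈ Finset.range L, (1 - Real.cos ((M + i + 1 : ℕ) * t)) := by
  have hpi := Real.pi_pos
  have hL' : (0 : ℝ) < L := by exact_mod_cast hL
  have ht0 : 0 < |t| := lt_of_lt_of_le (by positivity) ht
  have hsin : |t| / Real.pi ≤ |Real.sin (t / 2)| := by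
    have h := Real.mul_abs_le_abs_sin (x := t / 2) (by rw [abs_div, abs_two]; linarith)
    rw [abs_div, abs_two] at h
    calc |t| / Real.pi = 2 / Real.pi * (|t| / 2) := by ring
      _ ≤ _ := h
  have hkey := congrArg abs (two_mul_sin_mul_sum_cos M L t)
  rw [abs_mul, abs_mul, abs_two] at hkey
  have h2 : |Real.sin ((M + L + 1 / 2) * t) - Real.sin ((M + 1 / 2) * t)| ≤ 2 := by
    have h1 := Real.abs_sin_le_one ((M + L + 1 / 2) * t)
    have h2 := Real.abs_sin_le_one ((M + 1 / 2) * t)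
    exact (abs_sub _ _).trans (by linarith)
  set C := ∑ i ∈ Finset.range L, Real.cos ((M + i + 1 : ℕ) * t) with hC
  have h3 : |t| / Real.pi * |C| ≤ 1 := by
    have := mul_le_mul_of_nonneg_right hsin (abs_nonneg C)
    nlinarith
  have h4 : 2 / (L : ℝ) ≤ |t| / Real.pi := by
    rw [le_div_iff₀ hpi]
    calc 2 / (L : ℝ) * Real.pi = 2 * Real.pi / L := by ring
      _ ≤ _ := ht
  have h5 : 2 / (L : ℝ) * |C| ≤ 1 := (mul_le_mul_of_nonneg_right h4 (abs_nonneg C)).trans h3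
  have h6 : |C| ≤ L / 2 := by
    rw [div_mul_eq_mul_div, div_le_one hL'] at h5
    linarith
  rw [Finset.sum_sub_distrib, Finset.sum_const, Finset.card_range, nsmul_eq_mul, mul_one, ← hC]
  linarith [le_abs_self C]

theorem one_sub_cos_two_mul_le (u : ℝ) : 1 - Real.cos (2 * u) ≤ 4 * (1 - Real.cos u) := by
  rw [Real.cos_two_mul]
  nlinarith [sq_nonneg (1 - Real.cos u)]

/-- Low frequencies are reached from high ones by repeated doubling, since
`1 - cos (2u) ≤ 4 (1 - cos u)`. -/
theorem half_mul_min_le_sum_one_sub_cos (M : ℕ) {L : ℕ} (hL : 4 ≤ L) {t : ℝ}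
    (htpi : |t| ≤ Real.pi) :
    (L : ℝ) / 2 * min 1 ((L / (4 * Real.pi) * t) ^ 2) ≤
      ∑ i ∈ Finset.range L, (1 - Real.cos ((M + i + 1 : ℕ) * t)) := by
  have hpi := Real.pi_pos
  have hL' : (4 : ℝ) ≤ L := by exact_mod_cast hL
  have hind : ∀ (k : ℕ) (t : ℝ), 2 * Real.pi / L ≤ 2 ^ k * |t| → |t| ≤ Real.pi →
      (L : ℝ) / 2 * min 1 ((L / (4 * Real.pi) * t) ^ 2) ≤
        ∑ i ∈ Finset.range L, (1 - Real.cos ((M + i + 1 : ℕ) * t)) := by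
    intro k
    induction k with
    | zero =>
      intro t ht htp
      refine le_trans ?_ (half_le_sum_one_sub_cos (by omega) (by simpa using ht) htp)
      exact mul_le_of_le_one_right (by positivity) (min_le_left _ _)
    | succ k ih =>
      intro t ht htp
      rcases le_or_gt (2 * Real.pi / L) |t| with h | h
      · refine le_trans ?_ (half_le_sum_one_sub_cos (by omega) h htp)
        exact mul_le_of_le_one_right (by positivity) (min_le_left _ _)
      · have habs : |2 * t| = 2 * |t| := by rw [abs_mul, abs_two]
        have hlt : L * |t| < 2 * Real.pi := by
          rw [lt_div_iff₀ (by positivity)] at h; linarith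
        have h2 := ih (2 * t) (by rw [habs]; rw [pow_succ] at ht; linarith)
          (by rw [habs]; nlinarith [abs_nonneg t])
        have h3 : ∑ i ∈ Finset.range L, (1 - Real.cos ((M + i + 1 : ℕ) * (2 * t))) ≤
            4 * ∑ i ∈ Finset.range L, (1 - Real.cos ((M + i + 1 : ℕ) * t)) := by
          rw [Finset.mul_sum]
          refine Finset.sum_le_sum fun i _ => ?_
          rw [show ((M + i + 1 : ℕ) : ℝ) * (2 * t) = 2 * ((M + i + 1 : ℕ) * t) by ring]
          exact one_sub_cos_two_mul_le _
        have hsq : (L / (4 * Real.pi) * (2 * t)) ^ 2 ≤ 1 := by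
          rw [sq_le_one_iff_abs_le_one, abs_mul, abs_mul, abs_two, abs_of_pos (by positivity),
            div_mul_eq_mul_div, div_le_one (by positivity)]
          linarith
        rw [min_eq_right hsq] at h2
        refine (mul_le_mul_of_nonneg_left (min_le_right _ _) (by positivity)).trans ?_
        have h4 : (L : ℝ) / 2 * (L / (4 * Real.pi) * (2 * t)) ^ 2 =
          4 * ((L : ℝ) / 2 * (L / (4 * Real.pi) * t) ^ 2) := by ring
        linarith
  rcases eq_or_ne t 0 with rfl | h0
  · simp
  · obtain ⟨k, hk⟩ := pow_unbounded_of_one_lt (2 * Real.pi / L / |t|) (one_lt_two (α := ℝ))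
    exact hind k t ((div_le_iff₀ (abs_pos.2 h0)).1 hk.le) htpi

/-- The exponent of the modulus of the characteristic function of the long block, bounded below by
the window of its `L` largest cycle lengths. -/
theorem le_sum_blockExponent {ϑ x : ℝ} (hϑ : 0 < ϑ) (hx : 1 ≤ x) (b e : ℕ) {L : ℕ} (hL : 4 ≤ L)
    {t : ℝ} (ht : |t| ≤ Real.pi) :
    ϑ * x ^ (b + e) / (b + (e + L) : ℕ) * (L / 2) * min 1 ((L / (4 * Real.pi) * t) ^ 2) ≤
      ∑ j : Fin (e + L), ϑ * x ^ (b + j + 1) / (b + j + 1 : ℕ) *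
        (1 - Real.cos ((b + j + 1 : ℕ) * t)) := by
  have hx0 : 0 < x := by linarith
  rw [Fin.sum_univ_eq_sum_range (fun j => ϑ * x ^ (b + j + 1) / (b + j + 1 : ℕ) *
    (1 - Real.cos ((b + j + 1 : ℕ) * t))), Finset.sum_range_add]
  have h1 : 0 ≤ ∑ j ∈ Finset.range e, ϑ * x ^ (b + j + 1) / (b + j + 1 : ℕ) *
      (1 - Real.cos ((b + j + 1 : ℕ) * t)) :=
    Finset.sum_nonneg fun j _ =>
      mul_nonneg (by positivity) (by linarith [Real.cos_le_one ((b + j + 1 : ℕ) * t)])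
  refine le_trans ?_ (le_add_of_nonneg_left h1)
  rw [mul_assoc]
  refine (mul_le_mul_of_nonneg_left (half_mul_min_le_sum_one_sub_cos (b + e) hL ht)
    (by positivity)).trans ?_
  rw [Finset.mul_sum]
  refine Finset.sum_le_sum fun i hi => ?_
  rw [← add_assoc b e i]
  refine mul_le_mul_of_nonneg_right ?_
    (by linarith [Real.cos_le_one ((b + e + i + 1 : ℕ) * t)])
  have hi' := Finset.mem_range.1 hi
  have hc : ((b + e + i + 1 : ℕ) : ℝ) ≤ (b + (e + L) : ℕ) := by exact_mod_cast (by omega)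
  exact div_le_div₀ (by positivity)
    (mul_le_mul_of_nonneg_left (pow_le_pow_right₀ hx (by omega)) hϑ.le) (by positivity) hc

/-! ### Local limit estimates -/

theorem integral_abs_mul_exp_le {c D : ℝ} (hc : 0 < c) :
    ∫ t in (-Real.pi)..Real.pi, |t| * (D + Real.exp (-(c * t ^ 2))) ≤
      D * Real.pi ^ 2 + 1 / c := by
  have hpi := Real.pi_pos
  have hcont : Continuous fun t : ℝ => |t| * (D + Real.exp (-(c * t ^ 2))) := by fun_prop
  have hhalf : ∫ t in (0 : ℝ)..Real.pi, |t| * (D + Real.exp (-(c * t ^ 2))) =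
      D * Real.pi ^ 2 / 2 + (1 - Real.exp (-(c * Real.pi ^ 2))) / (2 * c) := by
    have hcongr : ∫ t in (0 : ℝ)..Real.pi, |t| * (D + Real.exp (-(c * t ^ 2))) =
        ∫ t in (0 : ℝ)..Real.pi, t * (D + Real.exp (-(c * t ^ 2))) := by
      refine intervalIntegral.integral_congr fun t ht => ?_
      rw [Set.uIcc_of_le hpi.le] at ht
      simp only [abs_of_nonneg ht.1]
    rw [hcongr, intervalIntegral.integral_eq_sub_of_hasDerivAt
      (f := fun t => D * t ^ 2 / 2 - Real.exp (-(c * t ^ 2)) / (2 * c))]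
    · simp
      field_simp
      ring
    · intro t _
      have h1 : HasDerivAt (fun t : ℝ => t ^ 2) (2 * t) t := by
        simpa using hasDerivAt_pow 2 t
      have h2 := ((h1.const_mul D).div_const 2).sub (((h1.const_mul c).neg.exp).div_const (2 * c))
      refine h2.congr_deriv ?_
      simp only [Pi.neg_apply]
      field_simp
      ring
    · exact Continuous.intervalIntegrable (by fun_prop) _ _
  have hneg : ∫ t in (-Real.pi)..(0 : ℝ), |t| * (D + Real.exp (-(c * t ^ 2))) =
      ∫ t in (0 : ℝ)..Real.pi, |t| * (D + Real.exp (-(c * t ^ 2))) := by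
    have := intervalIntegral.integral_comp_neg (a := 0) (b := Real.pi)
      fun t : ℝ => |t| * (D + Real.exp (-(c * t ^ 2)))
    simp only [abs_neg, neg_sq, neg_zero] at this
    exact this.symm
  rw [← intervalIntegral.integral_add_adjacent_intervals (b := 0)
    (hcont.intervalIntegrable _ _) (hcont.intervalIntegrable _ _), hneg, hhalf]
  have : (1 - Real.exp (-(c * Real.pi ^ 2))) / (2 * c) ≤ 1 / (2 * c) :=
    div_le_div_of_nonneg_right (by linarith [Real.exp_pos (-(c * Real.pi ^ 2))]) (by positivity)
  have e : 1 / c = 1 / (2 * c) + 1 / (2 * c) := by field_simp; norm_num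
  rw [e]
  linarith

/-- The Lipschitz bound for the law of the size of the long block. -/
theorem abs_blockLaw_real_sub_le {ϑ x : ℝ} (hϑ : 0 < ϑ) (hx : 1 ≤ x) (b e : ℕ) {L : ℕ}
    (hL : 4 ≤ L) {B κ : ℝ} (hB : B = ϑ * x ^ (b + e) / (b + (e + L) : ℕ) * (L / 2))
    (hκ : κ = L / (4 * Real.pi)) (k n : ℕ) :
    |(blockLaw (fun m => ϑ * x ^ m / m) b (e + L)).real {z | k + blockSize b (e + L) z = n} -
      (blockLaw (fun m => ϑ * x ^ m / m) b (e + L)).real {z | blockSize b (e + L) z = n}| ≤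
      ((2 * Real.pi)⁻¹ * (Real.exp (-B) * Real.pi ^ 2 + 1 / (B * κ ^ 2))) * k := by
  have hpi := Real.pi_pos
  have hx0 : 0 < x := by linarith
  have hμ : ∀ m : ℕ, 0 ≤ ϑ * x ^ m / m := fun m => by positivity
  have hL0 : (0 : ℝ) < L := by exact_mod_cast (by omega)
  have hB0 : 0 < B := by
    rw [hB]
    have : (0 : ℝ) < (b + (e + L) : ℕ) := by exact_mod_cast (by omega)
    positivity
  have hκ0 : 0 < κ := by rw [hκ]; positivity
  refine (abs_real_sub_real_le _ (measurable_blockSize b (e + L))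
    (h := fun t => Real.exp (-B) + Real.exp (-(B * κ ^ 2 * t ^ 2))) (by fun_prop) ?_
    (continuous_natCharFun_blockSize hμ b (e + L)) k n).trans ?_
  · intro t ht
    have h := le_sum_blockExponent hϑ hx b e hL ht
    rw [norm_natCharFun_blockSize hμ]
    rw [← hB, ← hκ] at h
    refine (Real.exp_le_exp.2 (neg_le_neg h)).trans ?_
    rcases le_total 1 ((κ * t) ^ 2) with h1 | h1
    · rw [min_eq_left h1, mul_one]
      exact le_add_of_nonneg_right (Real.exp_pos _).le
    · rw [min_eq_right h1, mul_pow, ← mul_assoc]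
      exact le_add_of_nonneg_left (Real.exp_pos _).le
  · refine mul_le_mul_of_nonneg_right (mul_le_mul_of_nonneg_left ?_ (by positivity))
      (Nat.cast_nonneg k)
    exact integral_abs_mul_exp_le (by positivity)

/-- The lower bound for the probability that Poisson variables with total mean size `n` have total
size exactly `n`. The window `|t| ≤ (n N)^(-1/2)` contributes its length, the phase keeps the
integrand nonnegative up to `|t|^3 n N^2 = 1`, and beyond that it is at most `exp (-M)`. -/
theorem le_two_pi_mul_twoBlockLaw_real {μ : ℕ → ℝ} (hμ : ∀ m, 0 ≤ μ m) {b d n N : ℕ}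
    (hN : b + d = N) (hN0 : 0 < N) (hNn : N ≤ n) (hn : ∑ m ∈ Finset.Icc 1 (b + d), m * μ m = n)
    {M : ℝ} (hM : ∀ t : ℝ, |t| ≤ Real.pi → 1 ≤ |t| ^ 3 * (n * N ^ 2) →
      M ≤ ∑ m ∈ Finset.Icc 1 (b + d), μ m * (1 - Real.cos (m * t))) :
    4 / 5 / Real.sqrt (n * N) - 2 * Real.pi * Real.exp (-M) ≤
      2 * Real.pi * (twoBlockLaw μ b d).real {ω | twoBlockSize b d ω = n} := by
  rw [two_pi_mul_twoBlockLaw_real_eq_integral hμ b d n hn]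
  have hpi := Real.pi_pos
  have hpi3 := Real.pi_gt_three
  have hNr : (1 : ℝ) ≤ N := by exact_mod_cast hN0
  have hNnr : (N : ℝ) ≤ n := by exact_mod_cast hNn
  set E : ℝ → ℝ := fun t => ∑ m ∈ Finset.Icc 1 (b + d), μ m * (1 - Real.cos (m * t)) with hE
  set θ : ℝ → ℝ := fun t => ∑ m ∈ Finset.Icc 1 (b + d), μ m * (Real.sin (m * t) - m * t) with hθ
  set g : ℝ → ℝ := fun t => Real.exp (-E t) * Real.cos (θ t) with hg
  have hgc : Continuous g := by simp only [hg, hE, hθ]; fun_prop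
  have hgi : ∀ u v, IntervalIntegrable g volume u v := fun u v => hgc.intervalIntegrable _ _
  set s := 1 / Real.sqrt (n * N) with hs
  have hnN : (1 : ℝ) ≤ n * N := by nlinarith
  have hsq : 1 ≤ Real.sqrt (n * N) := by rw [Real.one_le_sqrt]; exact hnN
  have hs0 : 0 < s := by positivity
  have hs1 : s ≤ 1 := by rw [hs, div_le_one (by positivity)]; exact hsq
  have hs2 : s ^ 2 * (n * N) = 1 := by
    rw [hs, div_pow, one_pow, Real.sq_sqrt (by positivity), one_div_mul_cancel (by positivity)]
  have hsum : ∀ p : ℕ, ∑ m ∈ Finset.Icc 1 (b + d), μ m * (m : ℝ) ^ (p + 1) ≤ n * N ^ p := by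
    intro p
    rw [← hn, Finset.sum_mul]
    refine Finset.sum_le_sum fun m hm => ?_
    have hmN : (m : ℝ) ≤ N := by
      rw [hN] at hm; exact_mod_cast (Finset.mem_Icc.1 hm).2
    calc μ m * (m : ℝ) ^ (p + 1) = m * μ m * (m : ℝ) ^ p := by ring
      _ ≤ m * μ m * (N : ℝ) ^ p := mul_le_mul_of_nonneg_left
        (pow_le_pow_left₀ (by positivity) hmN p) (mul_nonneg (by positivity) (hμ m))
  have hEle : ∀ t, E t ≤ t ^ 2 / 2 * (n * N) := by
    intro t
    have := hsum 1
    rw [pow_one] at this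
    refine le_trans ?_ (mul_le_mul_of_nonneg_left this (by positivity))
    rw [Finset.mul_sum]
    refine Finset.sum_le_sum fun m _ => ?_
    have h := Real.one_sub_sq_div_two_le_cos (x := m * t)
    calc μ m * (1 - Real.cos (m * t)) ≤ μ m * ((m * t) ^ 2 / 2) :=
          mul_le_mul_of_nonneg_left (by linarith) (hμ m)
      _ = _ := by ring
  have hθle : ∀ t, |θ t| ≤ |t| ^ 3 / 6 * (n * N ^ 2) := by
    intro t
    refine le_trans ?_ (mul_le_mul_of_nonneg_left (hsum 2) (by positivity))
    rw [Finset.mul_sum]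
    refine (Finset.abs_sum_le_sum_abs _ _).trans (Finset.sum_le_sum fun m _ => ?_)
    rw [abs_mul, abs_of_nonneg (hμ m), abs_sub_comm]
    calc μ m * |m * t - Real.sin (m * t)| ≤ μ m * (|m * t| ^ 3 / 6) :=
          mul_le_mul_of_nonneg_left (Real.abs_sub_sin_le _) (hμ m)
      _ = _ := by rw [abs_mul, abs_of_nonneg (Nat.cast_nonneg m)]; ring
  have hcos : ∀ t : ℝ, |t| ^ 3 * (n * N ^ 2) ≤ 1 → 71 / 72 ≤ Real.cos (θ t) := by
    intro t ht
    have h1 : |θ t| ≤ 1 / 6 := (hθle t).trans (by linarith)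
    have h2 := Real.one_sub_sq_div_two_le_cos (x := θ t)
    have h3 : θ t ^ 2 ≤ (1 / 6) ^ 2 := sq_le_sq' (abs_le.1 h1).1 (abs_le.1 h1).2
    linarith
  have hinner : ∀ t, |t| ≤ s → 2 / 5 ≤ g t := by
    intro t ht
    have ht2 : t ^ 2 ≤ s ^ 2 := by rw [← sq_abs]; exact pow_le_pow_left₀ (abs_nonneg t) ht 2
    have h1 : E t ≤ 1 / 2 := by
      refine (hEle t).trans ?_
      nlinarith
    have h2 : |t| ^ 3 * (n * N ^ 2) ≤ 1 := by
      have hsN : s * N ≤ 1 := by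
        have h : (s * N) ^ 2 ≤ 1 := by
          have : (N : ℝ) * N ≤ n * N := by nlinarith
          calc (s * N) ^ 2 = s ^ 2 * (N * N) := by ring
            _ ≤ s ^ 2 * (n * N) := by gcongr
            _ = 1 := hs2
        exact (sq_le_one_iff₀ (by positivity)).1 h
      calc |t| ^ 3 * (n * N ^ 2) ≤ s ^ 3 * (n * N ^ 2) := by gcongr
        _ = s ^ 2 * (n * N) * (s * N) := by ring
        _ ≤ 1 := by rw [hs2, one_mul]; exact hsN
    have h3 : 1 / 2 ≤ Real.exp (-E t) := by
      have := Real.add_one_le_exp (-E t)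
      linarith
    have := mul_le_mul h3 (hcos t h2) (by norm_num) (Real.exp_pos _).le
    simp only [hg]
    linarith
  have houter : ∀ t, |t| ≤ Real.pi → -Real.exp (-M) ≤ g t := by
    intro t ht
    rcases le_total (|t| ^ 3 * (n * N ^ 2)) 1 with h | h
    · have := mul_nonneg (Real.exp_pos (-E t)).le (show 0 ≤ Real.cos (θ t) by linarith [hcos t h])
      simp only [hg]
      linarith [Real.exp_pos (-M)]
    · have h1 : Real.exp (-E t) ≤ Real.exp (-M) := Real.exp_le_exp.2 (neg_le_neg (hM t ht h))
      have h2 := Real.neg_one_le_cos (θ t)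
      simp only [hg]
      nlinarith [Real.exp_pos (-E t)]
  have hI1 : -Real.exp (-M) * (-s - -Real.pi) ≤ ∫ t in (-Real.pi)..(-s), g t := by
    have := intervalIntegral.integral_mono_on (a := -Real.pi) (b := -s) (by linarith)
      (intervalIntegrable_const (c := -Real.exp (-M))) (hgi _ _)
      fun t ht => houter t (abs_le.2 ⟨ht.1, by linarith [ht.2]⟩)
    rw [intervalIntegral.integral_const, smul_eq_mul] at this
    linarith
  have hI2 : 2 / 5 * (s - -s) ≤ ∫ t in (-s)..s, g t := by
    have := intervalIntegral.integral_mono_on (a := -s) (b := s) (by linarith)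
      (intervalIntegrable_const (c := (2 / 5 : ℝ))) (hgi _ _)
      fun t ht => hinner t (abs_le.2 ⟨ht.1, ht.2⟩)
    rw [intervalIntegral.integral_const, smul_eq_mul] at this
    linarith
  have hI3 : -Real.exp (-M) * (Real.pi - s) ≤ ∫ t in s..Real.pi, g t := by
    have := intervalIntegral.integral_mono_on (a := s) (b := Real.pi) (by linarith)
      (intervalIntegrable_const (c := -Real.exp (-M))) (hgi _ _)
      fun t ht => houter t (abs_le.2 ⟨by linarith [ht.1], ht.2⟩)
    rw [intervalIntegral.integral_const, smul_eq_mul] at this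
    linarith
  have hsplit : ∫ t in (-Real.pi)..Real.pi, g t =
      (∫ t in (-Real.pi)..(-s), g t) + (∫ t in (-s)..s, g t) + ∫ t in s..Real.pi, g t := by
    rw [intervalIntegral.integral_add_adjacent_intervals (hgi _ _) (hgi _ _),
      intervalIntegral.integral_add_adjacent_intervals (hgi _ _) (hgi _ _)]
  rw [hsplit, show 4 / 5 / Real.sqrt (n * N) = 4 / 5 * s by rw [hs]; ring]
  nlinarith [Real.exp_pos (-M)]

/-! ### Explicit and asymptotic total variation bounds -/

/-- Lower bounds for the exponent `B * min 1 ((κ t)^2)`, given that the smallest of the `L` largest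
weights `w = ϑ x^(N - L)` is at least a fraction `1 / D` of the average `n / N` of all weights. -/
theorem window_bounds {n N ℓ L w D K B κ : ℝ} (hn : 0 < n) (hN : 0 < N) (hℓ : 1 ≤ ℓ) (hw : 0 < w)
    (hL : 0 < L) (hLN : N ≤ 2 * ℓ * L) (hD : 1 ≤ D) (hK : K = 2560 * D) (hnw : n ≤ N * D * w)
    (hNn : 8 * K ^ 3 * ℓ ^ 12 * N ≤ n) (hB : B = w / N * (L / 2)) (hκ : κ = L / (4 * Real.pi)) :
    0 < B ∧ n * N / (K * ℓ ^ 3) ≤ B * κ ^ 2 ∧ 2 * ℓ ≤ B ∧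
      ∀ t : ℝ, 1 ≤ |t| ^ 3 * (n * N ^ 2) → 2 * ℓ ≤ B * min 1 ((κ * t) ^ 2) := by
  have hpi := Real.pi_pos
  have hpi4 : Real.pi < 3.15 := Real.pi_lt_d2
  have hpisq : Real.pi ^ 2 ≤ 10 := by nlinarith
  have hℓ0 : 0 < ℓ := by linarith
  have hD0 : 0 < D := by linarith
  have hK1 : 2560 ≤ K := by rw [hK]; linarith
  have hK0 : 0 < K := by linarith
  have hBlow : n / (4 * D * N * ℓ) ≤ B := by
    rw [hB, div_le_iff₀ (by positivity)]
    have h1 : w / N * (L / 2) * (4 * D * N * ℓ) = D * w * (2 * ℓ * L) := by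
      field_simp; norm_num
    rw [h1]
    calc n ≤ N * D * w := hnw
      _ = D * w * N := by ring
      _ ≤ _ := mul_le_mul_of_nonneg_left hLN (by positivity)
  have hB0 : 0 < B := lt_of_lt_of_le (by positivity) hBlow
  have hκlow : N ^ 2 / (640 * ℓ ^ 2) ≤ κ ^ 2 := by
    rw [hκ, div_pow, div_le_div_iff₀ (by positivity) (by positivity)]
    have h1 : N ^ 2 ≤ (2 * ℓ * L) ^ 2 := pow_le_pow_left₀ hN.le hLN 2
    calc N ^ 2 * (4 * Real.pi) ^ 2 = N ^ 2 * (16 * Real.pi ^ 2) := by ring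
      _ ≤ (2 * ℓ * L) ^ 2 * (16 * 10) := by gcongr
      _ = _ := by ring
  have hBκ : n * N / (K * ℓ ^ 3) ≤ B * κ ^ 2 := by
    calc n * N / (K * ℓ ^ 3) = n / (4 * D * N * ℓ) * (N ^ 2 / (640 * ℓ ^ 2)) := by
          rw [hK]; field_simp; norm_num
      _ ≤ B * κ ^ 2 := mul_le_mul hBlow hκlow (by positivity) hB0.le
  have hB2 : 2 * ℓ ≤ B := by
    refine le_trans ?_ hBlow
    rw [le_div_iff₀ (by positivity)]
    refine le_trans ?_ hNn
    have h1 : ℓ ^ 2 ≤ ℓ ^ 12 := pow_le_pow_right₀ hℓ (by norm_num)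
    have h2 : D ≤ K ^ 3 := by
      calc D ≤ K := by rw [hK]; linarith
        _ = K ^ 1 := (pow_one K).symm
        _ ≤ K ^ 3 := pow_le_pow_right₀ (by linarith) (by norm_num)
    calc 2 * ℓ * (4 * D * N * ℓ) = 8 * D * ℓ ^ 2 * N := by ring
      _ ≤ 8 * K ^ 3 * ℓ ^ 12 * N := by gcongr
  refine ⟨hB0, hBκ, hB2, fun t h1 => ?_⟩
  -- The hypothesis is cubic in `t`, so `2 ℓ` and `B (κ t)^2` are compared through their cubes.
  have hcube : (2 * ℓ) ^ 3 ≤ (B * (κ * t) ^ 2) ^ 3 := by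
    have h2 : 1 ≤ t ^ 6 * (n * N ^ 2) ^ 2 := by
      have : t ^ 6 * (n * N ^ 2) ^ 2 = (|t| ^ 3 * (n * N ^ 2)) ^ 2 := by
        rw [← (show Even 6 by decide).pow_abs t]; ring
      rw [this]
      exact one_le_pow₀ h1
    have h3 : (n * N / (K * ℓ ^ 3)) ^ 3 ≤ (B * κ ^ 2) ^ 3 :=
      pow_le_pow_left₀ (by positivity) hBκ 3
    have h4 : (2 * ℓ) ^ 3 * (n * N ^ 2) ^ 2 ≤ (n * N / (K * ℓ ^ 3)) ^ 3 := by
      rw [div_pow, le_div_iff₀ (by positivity)]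
      calc (2 * ℓ) ^ 3 * (n * N ^ 2) ^ 2 * (K * ℓ ^ 3) ^ 3
          = 8 * K ^ 3 * ℓ ^ 12 * N * (n ^ 2 * N ^ 3) := by ring
        _ ≤ n * (n ^ 2 * N ^ 3) := mul_le_mul_of_nonneg_right hNn (by positivity)
        _ = (n * N) ^ 3 := by ring
    calc (2 * ℓ) ^ 3 ≤ (2 * ℓ) ^ 3 * (t ^ 6 * (n * N ^ 2) ^ 2) :=
          le_mul_of_one_le_right (by positivity) h2
      _ = (2 * ℓ) ^ 3 * (n * N ^ 2) ^ 2 * t ^ 6 := by ring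
      _ ≤ (B * κ ^ 2) ^ 3 * t ^ 6 :=
          mul_le_mul_of_nonneg_right (h4.trans h3) (Even.pow_nonneg (by decide) t)
      _ = _ := by ring
  have hmin : 2 * ℓ ≤ B * (κ * t) ^ 2 :=
    le_of_pow_le_pow_left₀ (by norm_num) (by positivity) hcube
  rcases le_total 1 ((κ * t) ^ 2) with h | h
  · rwa [min_eq_left h, mul_one]
  · rwa [min_eq_right h]

theorem one_tenth_div_le {S P ε : ℝ} (hS : 0 < S)
    (h : 4 / 5 / S - ε ≤ 2 * Real.pi * P) (hε : ε ≤ 1 / 10 / S) : 1 / 10 / S ≤ P := by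
  have hpi := Real.pi_pos
  have hpi4 : Real.pi < 3.15 := Real.pi_lt_d2
  have h1 : 0 < 1 / S := by positivity
  have h2 : 4 / 5 / S = 4 / 5 * (1 / S) := by ring
  have h3 : 1 / 10 / S = 1 / 10 * (1 / S) := by ring
  rw [h2] at h
  rw [h3] at hε ⊢
  nlinarith

theorem inv_two_pi_mul_le {V K ℓ E C : ℝ} (hV : 0 < V) (hK : 2560 ≤ K) (hℓ : 1 ≤ ℓ)
    (hE : E ≤ 1 / V) (hC : V / (K * ℓ ^ 3) ≤ C) :
    (2 * Real.pi)⁻¹ * (E * Real.pi ^ 2 + 1 / C) ≤ K * ℓ ^ 3 / V := by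
  have hpi3 := Real.pi_gt_three
  have hpi4 : Real.pi < 3.15 := Real.pi_lt_d2
  have hpisq : Real.pi ^ 2 ≤ 10 := by nlinarith
  have hℓ3 : 1 ≤ ℓ ^ 3 := one_le_pow₀ hℓ
  have hK0 : 0 < K := by linarith
  have hV1 : 0 < 1 / V := by positivity
  have h2 : 1 / C ≤ K * ℓ ^ 3 / V := by
    rw [← one_div_div V]
    exact one_div_le_one_div_of_le (by positivity) hC
  have h3 : E * Real.pi ^ 2 ≤ 1 / V * 10 :=
    (mul_le_mul_of_nonneg_right hE (by positivity)).trans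
      (mul_le_mul_of_nonneg_left hpisq hV1.le)
  have h4 : 1 / V * 10 ≤ K * ℓ ^ 3 / V := by
    rw [div_mul_eq_mul_div]
    exact div_le_div_of_nonneg_right (by nlinarith) hV.le
  have h5 : 0 ≤ K * ℓ ^ 3 / V := by positivity
  rw [inv_mul_le_iff₀ (by positivity)]
  nlinarith

/-- The explicit total variation bound: the Lipschitz constant is of order `ℓ^3 / (n N)` and the
probability of total size `n` of order `1 / √(n N)`, up to constants, where `ℓ = log n`. -/
theorem tvDist_cycleCountLaw_le_of_saddle {ϑ x : ℝ} (hϑ : 0 < ϑ) (hx : 1 ≤ x) {n N b L : ℕ}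
    {a : ℝ} (ha : 0 ≤ a) (hfl : ⌊a⌋₊ = N) (hsaddle : (n : ℝ) = ϑ * ∑ j ∈ Finset.Icc 1 N, x ^ j)
    (hn : 70 ≤ n) (hℓ : 1 ≤ Real.log n) (hL : 4 ≤ L) (hbL : b + L ≤ N)
    (hLN : (N : ℝ) ≤ 2 * Real.log n * L) {D K : ℝ} (hD : 1 ≤ D) (hxL : x ^ L ≤ D)
    (hK : K = 2560 * D) (hNn : 8 * K ^ 3 * Real.log n ^ 12 * N ≤ n) :
    tvDist (cycleCountLaw ϑ n a b) (blockLaw (fun m => ϑ * x ^ m / m) 0 b) ≤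
      20 * K * ϑ * (Real.log n ^ 3 * (b * x ^ b) / Real.sqrt (n * N)) := by
  obtain ⟨e, he⟩ := Nat.exists_eq_add_of_le hbL
  have hNe : b + (e + L) = N := by omega
  set ℓ := Real.log n with hℓdef
  have hpi := Real.pi_pos
  have hpi4 : Real.pi < 3.15 := Real.pi_lt_d2
  have hx0 : 0 < x := by linarith
  have hNr : (4 : ℝ) ≤ N := by exact_mod_cast (by omega)
  have hN0 : (0 : ℝ) < N := by linarith
  have hLr : (4 : ℝ) ≤ L := by exact_mod_cast hL
  have hnr : (70 : ℝ) ≤ n := by exact_mod_cast hn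
  have hn0 : (0 : ℝ) < n := by linarith
  have hℓ0 : 0 < ℓ := by linarith
  have hD0 : 0 < D := by linarith
  have hK1 : 2560 ≤ K := by rw [hK]; linarith
  have hK0 : 0 < K := by linarith
  have hℓ12 : 1 ≤ ℓ ^ 12 := one_le_pow₀ hℓ
  have hNle : (N : ℝ) ≤ n := by
    refine le_trans ?_ hNn
    have h1 : 1 ≤ K ^ 3 := one_le_pow₀ (by linarith)
    have h2 : 1 ≤ 8 * K ^ 3 * ℓ ^ 12 := by nlinarith
    nlinarith
  set B : ℝ := ϑ * x ^ (b + e) / (b + (e + L) : ℕ) * (L / 2) with hB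
  set κ : ℝ := L / (4 * Real.pi) with hκ
  clear_value ℓ B κ
  -- The largest of the `N` terms of the saddle point equation is at least their average.
  have hxN : n ≤ N * (ϑ * x ^ N) := by
    rw [hsaddle]
    have : ∑ j ∈ Finset.Icc 1 N, x ^ j ≤ N * x ^ N := by
      calc ∑ j ∈ Finset.Icc 1 N, x ^ j ≤ ∑ j ∈ Finset.Icc 1 N, x ^ N :=
            Finset.sum_le_sum fun j hj => pow_le_pow_right₀ hx (Finset.mem_Icc.1 hj).2
        _ = N * x ^ N := by simp
    nlinarith
  have hxbe : n ≤ N * D * (ϑ * x ^ (b + e)) := by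
    refine hxN.trans ?_
    have : x ^ N = x ^ (b + e) * x ^ L := by rw [← pow_add]; congr 1; omega
    rw [this]
    calc (N : ℝ) * (ϑ * (x ^ (b + e) * x ^ L)) = N * (ϑ * x ^ (b + e)) * x ^ L := by ring
      _ ≤ N * (ϑ * x ^ (b + e)) * D := mul_le_mul_of_nonneg_left hxL (by positivity)
      _ = _ := by ring
  obtain ⟨hB0, hBκ, hB2, hBt⟩ := window_bounds hn0 hN0 hℓ (by positivity) (by linarith) hLN hD hK
    hxbe hNn (B := B) (by rw [hB, hNe]) hκ
  have hexpM : Real.exp (-(2 * ℓ)) = 1 / (n : ℝ) ^ 2 := by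
    rw [Real.exp_neg, two_mul, Real.exp_add, hℓdef, Real.exp_log hn0]
    field_simp
  have hμ : ∀ m : ℕ, 0 ≤ ϑ * x ^ m / m := fun m => by positivity
  have hnsum : ∑ m ∈ Finset.Icc 1 (b + (e + L)), (m : ℝ) * (ϑ * x ^ m / m) = n := by
    rw [hsaddle, hNe, Finset.mul_sum]
    refine Finset.sum_congr rfl fun m hm => ?_
    have : (0 : ℝ) < m := by exact_mod_cast (Finset.mem_Icc.1 hm).1
    field_simp
  have hM : ∀ t : ℝ, |t| ≤ Real.pi → 1 ≤ |t| ^ 3 * (n * N ^ 2) →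
      2 * ℓ ≤ ∑ m ∈ Finset.Icc 1 (b + (e + L)), ϑ * x ^ m / m * (1 - Real.cos (m * t)) := by
    intro t ht h1
    rw [sum_Icc_add]
    refine le_trans ?_ (le_add_of_nonneg_left (Finset.sum_nonneg fun j _ =>
      mul_nonneg (hμ _) (sub_nonneg.2 (Real.cos_le_one _))))
    refine le_trans ?_ (le_sum_blockExponent hϑ hx b e hL ht)
    rw [← hB, ← hκ]
    exact hBt t h1
  have hsq0 : 0 < Real.sqrt (n * N) := Real.sqrt_pos.2 (by positivity)
  have hsqsq : Real.sqrt (n * N) ^ 2 = n * N := Real.sq_sqrt (by positivity)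
  have hsqn : Real.sqrt (n * N) ≤ n := by
    rw [Real.sqrt_le_left hn0.le, sq]; exact mul_le_mul_of_nonneg_left hNle hn0.le
  have hqle : 1 / 10 / Real.sqrt (n * N) ≤ (twoBlockLaw (fun m => ϑ * x ^ m / m) b (e + L)).real
      {ω | twoBlockSize b (e + L) ω = n} := by
    have h := le_two_pi_mul_twoBlockLaw_real hμ hNe (by omega) (by exact_mod_cast hNle) hnsum hM
    rw [hexpM] at h
    have h1 : 2 * Real.pi * (1 / (n : ℝ) ^ 2) ≤ 1 / 10 / Real.sqrt (n * N) := by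
      rw [mul_one_div, div_le_div_iff₀ (by positivity) hsq0]
      calc 2 * Real.pi * Real.sqrt (n * N) ≤ 7 * n := by gcongr; linarith
        _ = 1 / 10 * (70 * n) := by ring
        _ ≤ 1 / 10 * n ^ 2 := by rw [sq]; gcongr
    exact one_tenth_div_le (by positivity) h h1
  set Λ : ℝ := (2 * Real.pi)⁻¹ * (Real.exp (-B) * Real.pi ^ 2 + 1 / (B * κ ^ 2)) with hΛ
  have hΛle : Λ ≤ K * ℓ ^ 3 / (n * N) := by
    have h1 : Real.exp (-B) ≤ 1 / (n * N) := by
      refine (Real.exp_le_exp.2 (neg_le_neg hB2)).trans ?_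
      rw [hexpM]
      exact one_div_le_one_div_of_le (by positivity)
        (by rw [sq]; exact mul_le_mul_of_nonneg_left hNle hn0.le)
    exact inv_two_pi_mul_le (by positivity) hK1 hℓ h1 hBκ
  have hΛ0 : 0 ≤ Λ := by positivity
  clear_value Λ
  refine (tvDist_cycleCountLaw_le hϑ hx0 (by omega) (by rw [hNe]; exact_mod_cast hNle) ha
    (by rw [hfl, hNe]) (by positivity)
    (fun k => abs_blockLaw_real_sub_le hϑ hx b e hL hB hκ k n) hqle).trans ?_
  rw [← hΛ]
  have hmean : ∑ j ∈ Finset.Icc 1 b, x ^ j ≤ b * x ^ b := by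
    calc ∑ j ∈ Finset.Icc 1 b, x ^ j ≤ ∑ j ∈ Finset.Icc 1 b, x ^ b :=
          Finset.sum_le_sum fun j hj => pow_le_pow_right₀ hx (Finset.mem_Icc.1 hj).2
      _ = b * x ^ b := by simp
  rw [div_le_iff₀ (by positivity)]
  calc 2 * Λ * (ϑ * ∑ j ∈ Finset.Icc 1 b, x ^ j)
      ≤ 2 * (K * ℓ ^ 3 / (n * N)) * (ϑ * (b * x ^ b)) := by gcongr
    _ = _ := by
      generalize Real.sqrt (n * N) = S at hsqsq hsq0
      rw [← hsqsq]
      field_simp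
      ring

theorem tvDist_nonneg {Ω : Type*} [MeasurableSpace Ω] (μ ν : Measure Ω) : 0 ≤ tvDist μ ν :=
  Real.iSup_nonneg fun _ => abs_nonneg _

theorem poissonLaw_eq_blockLaw (ϑ : ℝ) (n : ℕ) (a : ℝ) (b : ℕ) :
    poissonLaw ϑ n a b = blockLaw (fun m => ϑ * saddlePoint ϑ n a ^ m / m) 0 b := by
  simp only [poissonLaw, blockLaw, poissonMean, zero_add]

theorem eventually_mul_log_pow_le (c : ℝ) (k : ℕ) {r : ℝ} (hr : 0 < r) :
    ∀ᶠ n : ℕ in atTop, c * Real.log n ^ k ≤ (n : ℝ) ^ r := by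
  have h := (isLittleO_log_rpow_rpow_atTop (k : ℝ) hr).comp_tendsto tendsto_natCast_atTop_atTop
  have hc : 0 < (|c| + 1)⁻¹ := by positivity
  filter_upwards [h.def hc, eventually_ge_atTop 1] with n hn hn1
  have hn1' : (1 : ℝ) ≤ n := by exact_mod_cast hn1
  have hlog := Real.log_nonneg hn1'
  simp only [Function.comp, Real.rpow_natCast] at hn
  rw [Real.norm_of_nonneg (by positivity), Real.norm_of_nonneg (by positivity),
    inv_mul_eq_div, le_div_iff₀ (by positivity)] at hn
  have : 0 ≤ Real.log n ^ k := by positivity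
  nlinarith [le_abs_self c]

/-- The total variation bound in terms of the tilt `x = x_{n,α}`, with a factor `log n ^ 3` that is
absorbed by the twelfth root of `α / n`. -/
theorem exists_eventually_tvDist_le {ϑ : ℝ} (hϑ : 0 < ϑ) {a₁ a₂ : ℝ} (ha₁ : 0 < a₁) (ha₂ : a₂ < 1)
    {α : ℕ → ℝ} (hα : ∀ᶠ n : ℕ in atTop, (n : ℝ) ^ a₁ ≤ α n ∧ α n ≤ (n : ℝ) ^ a₂)
    {b : ℕ → ℕ} (hb : (fun n => (b n : ℝ)) =o[atTop] α) :
    ∃ C : ℝ, 0 < C ∧ ∀ᶠ n : ℕ in atTop,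
      1 ≤ Real.log n ∧ 0 < α n ∧ (b n : ℝ) ≤ α n ∧ 1 ≤ saddlePoint ϑ n (α n) ∧
      α n * Real.log (saddlePoint ϑ n (α n)) ≤ 4 * Real.log n ∧
      Real.log n ^ 3 * (α n / n) ^ (1 / 12 : ℝ) ≤ 1 ∧
      tvDist (cycleCountLaw ϑ n (α n) (b n)) (poissonLaw ϑ n (α n) (b n)) ≤
        C * (Real.log n ^ 3 * (b n * saddlePoint ϑ n (α n) ^ b n) / Real.sqrt (n * α n)) := by
  set D : ℝ := Real.exp 2 with hD
  set K : ℝ := 2560 * D with hK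
  have hD1 : 1 ≤ D := Real.one_le_exp (by norm_num)
  have hK1 : 1 ≤ K := by rw [hK]; linarith
  have ha₂' : 0 < 1 - a₂ := by linarith
  have hlog := Real.tendsto_log_atTop.comp (tendsto_natCast_atTop_atTop (R := ℝ))
  refine ⟨40 * K * ϑ, by positivity, ?_⟩
  filter_upwards [hα, hb.def (show (0 : ℝ) < 1 / 4 by norm_num),
    eventually_mul_log_pow_le 16 1 ha₁, eventually_mul_log_pow_le (8 * K ^ 3) 12 ha₂',
    eventually_mul_log_pow_le 1 36 ha₂', eventually_ge_atTop 70, hlog.eventually_ge_atTop 2,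
    hlog.eventually_ge_atTop ϑ,
    (tendsto_natCast_atTop_atTop (R := ℝ)).eventually_ge_atTop (1 / ϑ)]
    with n ⟨hα1, hα2⟩ hbn h16 hK12 h36 hn70 hℓ2 hℓϑ hnϑ
  simp only [Function.comp] at hℓ2 hℓϑ
  rw [pow_one] at h16
  have hnr : (70 : ℝ) ≤ n := by exact_mod_cast hn70
  have hn0 : (0 : ℝ) < n := by linarith
  set ℓ := Real.log n with hℓ
  have hαℓ : 16 * ℓ ≤ α n := h16.trans hα1
  have hα32 : 32 ≤ α n := by linarith
  have hα0 : 0 < α n := by linarith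
  rw [Real.norm_of_nonneg (by positivity), Real.norm_of_nonneg hα0.le] at hbn
  set N := ⌊α n⌋₊ with hN
  have hNα : (N : ℝ) ≤ α n := Nat.floor_le hα0.le
  have hαN : α n < N + 1 := Nat.lt_floor_add_one _
  have hN8 : 8 * ℓ ≤ N := by linarith
  have hN0 : (0 : ℝ) < N := by linarith
  have hαn : (n : ℝ) ^ (1 - a₂) * α n ≤ n := by
    calc (n : ℝ) ^ (1 - a₂) * α n ≤ (n : ℝ) ^ (1 - a₂) * (n : ℝ) ^ a₂ :=
          mul_le_mul_of_nonneg_left hα2 (by positivity)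
      _ = n := by rw [← Real.rpow_add hn0, sub_add_cancel, Real.rpow_one]
  have hNn : 8 * K ^ 3 * ℓ ^ 12 * N ≤ n :=
    (mul_le_mul hK12 hNα hN0.le (by positivity)).trans hαn
  obtain ⟨hx0, hsaddle⟩ := saddlePoint_spec hϑ (show 1 ≤ n by omega) (show 1 ≤ α n by linarith)
  rw [← hN] at hsaddle
  set x := saddlePoint ϑ n (α n) with hx
  -- A tilt below `1` would give a total mean size of at most `ϑ N < n`.
  have hx1 : 1 ≤ x := by
    by_contra! hlt
    have h1 : ∑ j ∈ Finset.Icc 1 N, x ^ j ≤ N := by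
      calc ∑ j ∈ Finset.Icc 1 N, x ^ j ≤ ∑ j ∈ Finset.Icc 1 N, (1 : ℝ) :=
            Finset.sum_le_sum fun j _ => pow_le_one₀ hx0.le hlt.le
        _ = N := by simp
    have h2 : (n : ℝ) ≤ ℓ * N := by
      rw [hsaddle]
      exact mul_le_mul hℓϑ h1 (Finset.sum_nonneg fun j _ => by positivity) (by linarith)
    have h3 : ℓ ≤ ℓ ^ 12 := le_self_pow₀ (by linarith) (by norm_num)
    have h4 : 1 ≤ K ^ 3 := one_le_pow₀ hK1
    have h5 : 8 * ℓ ^ 12 ≤ 8 * K ^ 3 * ℓ ^ 12 := by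
      have : 0 < ℓ ^ 12 := by positivity
      nlinarith
    nlinarith
  have hlogx : 0 ≤ Real.log x := Real.log_nonneg hx1
  have hNpos : 1 ≤ N := by exact_mod_cast (show (0 : ℝ) < N from hN0)
  have hxN : x ^ N ≤ (n : ℝ) ^ 2 := by
    have h1 : x ^ N ≤ ∑ j ∈ Finset.Icc 1 N, x ^ j :=
      Finset.single_le_sum (f := fun j => x ^ j) (fun j _ => by positivity)
        (Finset.mem_Icc.2 ⟨hNpos, le_rfl⟩)
    have h2 : ϑ * x ^ N ≤ n := by
      rw [hsaddle]; exact mul_le_mul_of_nonneg_left h1 hϑ.le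
    rw [div_le_iff₀ hϑ] at hnϑ
    have h3 : x ^ N * 1 ≤ x ^ N * (n * ϑ) := mul_le_mul_of_nonneg_left hnϑ (by positivity)
    nlinarith
  have hNlog : N * Real.log x ≤ 2 * ℓ := by
    have := Real.log_le_log (by positivity) hxN
    rwa [Real.log_pow, Real.log_pow, Nat.cast_ofNat] at this
  set L := ⌊(N : ℝ) / ℓ⌋₊ with hL
  have hNℓ8 : 8 ≤ (N : ℝ) / ℓ := by rw [le_div_iff₀ (by linarith)]; exact hN8
  have hLle : (L : ℝ) ≤ N / ℓ := Nat.floor_le (by positivity)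
  have hLlt : (N : ℝ) / ℓ < L + 1 := Nat.lt_floor_add_one _
  have hL4 : 4 ≤ L := by
    have : (4 : ℝ) ≤ L := by linarith
    exact_mod_cast this
  have hbL : b n + L ≤ N := by
    have h1 : (N : ℝ) / ℓ ≤ N / 2 := by gcongr
    have : (b n : ℝ) + L ≤ N := by linarith
    exact_mod_cast this
  have hLN : (N : ℝ) ≤ 2 * ℓ * L := by
    have h1 : (N : ℝ) / ℓ ≤ 2 * L := by linarith
    rw [div_le_iff₀ (by linarith)] at h1
    linarith
  have hxL : x ^ L ≤ D := by
    rw [← Real.exp_log hx0, ← Real.exp_nat_mul, hD]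
    refine Real.exp_le_exp.2 ?_
    calc (L : ℝ) * Real.log x ≤ N / ℓ * Real.log x := by gcongr
      _ = N * Real.log x / ℓ := by ring
      _ ≤ 2 := by rw [div_le_iff₀ (by linarith)]; exact hNlog
  refine ⟨by linarith, hα0, by linarith, hx1, ?_, ?_, ?_⟩
  · calc α n * Real.log x ≤ 2 * N * Real.log x := by
          apply mul_le_mul_of_nonneg_right _ hlogx
          linarith
      _ = 2 * (N * Real.log x) := by ring
      _ ≤ 4 * ℓ := by linarith
  · have h1 : ℓ ^ 36 * (α n / n) ≤ 1 := by
      rw [← mul_div_assoc, div_le_one hn0]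
      rw [one_mul] at h36
      exact (mul_le_mul_of_nonneg_right h36 hα0.le).trans hαn
    have h2 := Real.rpow_le_rpow (by positivity) h1 (show (0 : ℝ) ≤ 1 / 12 by norm_num)
    rw [Real.one_rpow, Real.mul_rpow (by positivity) (by positivity), ← Real.rpow_natCast,
      ← Real.rpow_mul (by linarith)] at h2
    rw [← Real.rpow_natCast]
    norm_num at h2 ⊢
    exact h2
  · rw [poissonLaw_eq_blockLaw, ← hx]
    refine (tvDist_cycleCountLaw_le_of_saddle hϑ hx1 hα0.le hN.symm hsaddle hn70 (by linarith) hL4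
      hbL hLN hD1 hxL hK hNn).trans ?_
    have hsqrt : Real.sqrt (n * α n) ≤ 2 * Real.sqrt (n * N) := by
      rw [show (2 : ℝ) = Real.sqrt (2 ^ 2) by rw [Real.sqrt_sq (by norm_num)],
        ← Real.sqrt_mul (by norm_num)]
      exact Real.sqrt_le_sqrt (by nlinarith)
    have hs0 : 0 < Real.sqrt (n * α n) := Real.sqrt_pos.2 (by positivity)
    have hs1 : 0 < Real.sqrt (n * N) := Real.sqrt_pos.2 (by positivity)
    have hℓ0 : 0 ≤ ℓ := by linarith
    set Q := ℓ ^ 3 * (b n * x ^ b n) with hQ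
    have hQ0 : 0 ≤ Q := by positivity
    have h1 : Q / Real.sqrt (n * N) ≤ 2 * (Q / Real.sqrt (n * α n)) := by
      rw [← mul_div_assoc, div_le_div_iff₀ hs1 hs0]
      calc Q * Real.sqrt (n * α n) ≤ Q * (2 * Real.sqrt (n * N)) :=
            mul_le_mul_of_nonneg_left hsqrt hQ0
        _ = _ := by ring
    calc 20 * K * ϑ * (Q / Real.sqrt (n * N))
        ≤ 20 * K * ϑ * (2 * (Q / Real.sqrt (n * α n))) :=
          mul_le_mul_of_nonneg_left h1 (by positivity)
      _ = _ := by ring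

/-- Lowering one exponent `1/2` by a twelfth and raising the other costs a twelfth root of
`a / n`: this is the room that absorbs the logarithms. -/
theorem one_div_sqrt_mul_eq {n a : ℝ} (hn : 0 < n) (ha : 0 < a) :
    1 / Real.sqrt (n * a) =
      (a / n) ^ (1 / 12 : ℝ) / (n ^ (5 / 12 : ℝ) * a ^ (7 / 12 : ℝ)) := by
  rw [Real.sqrt_eq_rpow, Real.mul_rpow hn.le ha.le, Real.div_rpow ha.le hn.le, div_div,
    div_eq_div_iff (by positivity) (by positivity)]
  have h1 : n ^ (1 / 2 : ℝ) = n ^ (1 / 12 : ℝ) * n ^ (5 / 12 : ℝ) := by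
    rw [← Real.rpow_add hn]; norm_num
  have h2 : a ^ (7 / 12 : ℝ) = a ^ (1 / 12 : ℝ) * a ^ (1 / 2 : ℝ) := by
    rw [← Real.rpow_add ha]; norm_num
  rw [h1, h2]
  ring

theorem div_rpow_mul_rpow_eq {n a : ℝ} (hn : 0 < n) (ha : 0 < a) :
    a / (n ^ (5 / 12 : ℝ) * a ^ (7 / 12 : ℝ)) = (a / n) ^ (5 / 12 : ℝ) := by
  have h : a = a ^ (5 / 12 : ℝ) * a ^ (7 / 12 : ℝ) := by
    rw [← Real.rpow_add ha]; norm_num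
  rw [Real.div_rpow ha.le hn.le, div_eq_div_iff (by positivity) (by positivity)]
  nth_rewrite 1 [h]
  ring

theorem pow_eq_exp_mul_log {x : ℝ} (hx : 0 < x) (b : ℕ) : x ^ b = Real.exp (b * Real.log x) := by
  rw [Real.exp_nat_mul, Real.exp_log hx]

end RestrictedEwens

end

theorem theorem2p10 (ϑ : ℝ) (hϑ : 0 < ϑ)
    (a₁ a₂ : ℝ) (ha₁ : a₁ ∈ Set.Ioo (0 : ℝ) 1) (ha₂ : a₂ ∈ Set.Ioo (0 : ℝ) 1)
    (α : ℕ → ℝ) (hα : ∀ᶠ n : ℕ in atTop, (n : ℝ) ^ a₁ ≤ α n ∧ α n ≤ (n : ℝ) ^ a₂)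
    (b : ℕ → ℕ) (hb : (fun n => (b n : ℝ)) =o[atTop] α) :
    (∀ ε : ℝ, 0 < ε →
      (fun n : ℕ => RestrictedEwens.tvDist
          (RestrictedEwens.cycleCountLaw ϑ n (α n) (b n))
          (RestrictedEwens.poissonLaw ϑ n (α n) (b n)))
        =O[atTop] fun n : ℕ => (n : ℝ) ^ ε * (α n / n) ^ (5 / 12 : ℝ)) ∧
    ((fun n => (b n : ℝ)) =o[atTop] (fun n : ℕ => α n / Real.log n) →
      (fun n : ℕ => RestrictedEwens.tvDist
          (RestrictedEwens.cycleCountLaw ϑ n (α n) (b n))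
          (RestrictedEwens.poissonLaw ϑ n (α n) (b n)))
        =O[atTop] fun n : ℕ => α n / n +
          b n * Real.log n / ((n : ℝ) ^ (5 / 12 : ℝ) * α n ^ (7 / 12 : ℝ))) := by
  obtain ⟨C, hC, hev⟩ := RestrictedEwens.exists_eventually_tvDist_le hϑ ha₁.1 ha₂.2 hα hb
  refine ⟨fun ε hε => ?_, fun hb' => ?_⟩
  · refine IsBigO.of_bound C ?_
    filter_upwards [hev, hb.def (show 0 < ε / 4 by positivity), eventually_ge_atTop 1]
      with n ⟨hℓ, hα0, hbα, hx1, hαx, hη, htv⟩ hbε hn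
    have hn0 : (0 : ℝ) < n := by exact_mod_cast hn
    rw [Real.norm_of_nonneg (Nat.cast_nonneg _), Real.norm_of_nonneg hα0.le] at hbε
    rw [Real.norm_of_nonneg (RestrictedEwens.tvDist_nonneg _ _),
      Real.norm_of_nonneg (by positivity)]
    refine htv.trans (mul_le_mul_of_nonneg_left ?_ hC.le)
    set x := RestrictedEwens.saddlePoint ϑ n (α n)
    have hlogx : 0 ≤ Real.log x := Real.log_nonneg hx1
    -- Since `α log x ≤ 4 log n`, the means grow by at most `n^ε` over a block of length `o(α)`.
    have hxb : x ^ b n ≤ (n : ℝ) ^ ε := by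
      rw [RestrictedEwens.pow_eq_exp_mul_log (by linarith), Real.rpow_def_of_pos hn0]
      refine Real.exp_le_exp.2 ?_
      calc (b n : ℝ) * Real.log x ≤ ε / 4 * α n * Real.log x := by gcongr
        _ = ε / 4 * (α n * Real.log x) := by ring
        _ ≤ ε / 4 * (4 * Real.log n) := by gcongr
        _ = Real.log n * ε := by ring
    have hℓ0 : 0 ≤ Real.log n := by linarith
    set G := (n : ℝ) ^ (5 / 12 : ℝ) * α n ^ (7 / 12 : ℝ) with hG
    have hG0 : 0 < G := by positivity
    calc Real.log n ^ 3 * (b n * x ^ b n) / Real.sqrt (n * α n)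
        ≤ Real.log n ^ 3 * (α n * (n : ℝ) ^ ε) / Real.sqrt (n * α n) := by gcongr
      _ = Real.log n ^ 3 * (α n * (n : ℝ) ^ ε) * (1 / Real.sqrt (n * α n)) := by ring
      _ = (Real.log n ^ 3 * (α n / n) ^ (1 / 12 : ℝ)) * ((n : ℝ) ^ ε * (α n / G)) := by
        rw [RestrictedEwens.one_div_sqrt_mul_eq hn0 hα0]; ring
      _ ≤ 1 * ((n : ℝ) ^ ε * (α n / G)) := by gcongr
      _ = _ := by rw [one_mul, hG, RestrictedEwens.div_rpow_mul_rpow_eq hn0 hα0]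
  · refine IsBigO.of_bound (C * Real.exp 4) ?_
    filter_upwards [hev, hb'.def (show (0 : ℝ) < 1 by norm_num), eventually_ge_atTop 1]
      with n ⟨hℓ, hα0, hbα, hx1, hαx, hη, htv⟩ hb1 hn
    have hn0 : (0 : ℝ) < n := by exact_mod_cast hn
    have hℓ0 : 0 < Real.log n := by linarith
    rw [Real.norm_of_nonneg (Nat.cast_nonneg _), Real.norm_of_nonneg (by positivity),
      one_mul] at hb1
    rw [Real.norm_of_nonneg (RestrictedEwens.tvDist_nonneg _ _),
      Real.norm_of_nonneg (by positivity), mul_assoc]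
    refine htv.trans (mul_le_mul_of_nonneg_left ?_ hC.le)
    set x := RestrictedEwens.saddlePoint ϑ n (α n)
    have hlogx : 0 ≤ Real.log x := Real.log_nonneg hx1
    have hxb : x ^ b n ≤ Real.exp 4 := by
      rw [RestrictedEwens.pow_eq_exp_mul_log (by linarith)]
      refine Real.exp_le_exp.2 ?_
      calc (b n : ℝ) * Real.log x ≤ α n / Real.log n * Real.log x := by gcongr
        _ = α n * Real.log x / Real.log n := by ring
        _ ≤ 4 := by rw [div_le_iff₀ hℓ0]; exact hαx
    set G := (n : ℝ) ^ (5 / 12 : ℝ) * α n ^ (7 / 12 : ℝ) with hG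
    have hG0 : 0 < G := by positivity
    calc Real.log n ^ 3 * (b n * x ^ b n) / Real.sqrt (n * α n)
        ≤ Real.log n ^ 3 * (b n * Real.exp 4) / Real.sqrt (n * α n) := by gcongr
      _ = Real.log n ^ 3 * (b n * Real.exp 4) * (1 / Real.sqrt (n * α n)) := by ring
      _ = (Real.log n ^ 3 * (α n / n) ^ (1 / 12 : ℝ)) * (Real.exp 4 * (b n / G)) := by
        rw [RestrictedEwens.one_div_sqrt_mul_eq hn0 hα0]; ring
      _ ≤ Real.log n * (Real.exp 4 * (b n / G)) := by gcongr; linarith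
      _ = Real.exp 4 * (b n * Real.log n / G) := by ring
      _ ≤ Real.exp 4 * (α n / n + b n * Real.log n / G) := by
        gcongr
        exact le_add_of_nonneg_left (by positivity)
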